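/- Let $\mathrm{Diff}^2_+([0,1])$ be the group of orientation-preserving $C^2$ diffeomorphisms of $[0,1]$ (one-sided derivatives at the endpoints), with the $C^2$ topology, i.e. uniform convergence on $[0,1]$ of the maps together with their first and second derivatives. Let $f\in\mathrm{Diff}^2_+([0,1])$ have no fixed point in the open interval $(0,1)$, and suppose that both endpoints are parabolic fixed points of $f$, i.e. $Df(0)=Df(1)=1$. If the $C^2$ centralizer $\{g\in\mathrm{Diff}^2_+([0,1]) : fg=gf\}$ of $f$ is not an infinite cyclic group, then the identity belongs to the $C^2$ closure of the $C^2$ conjugacy class of $f$: for every $\varepsilon>0$ there is $h\in\mathrm{Diff}^2_+([0,1])$ such that $$\sup_{x\in[0,1]}\bigl|D^k(h\circ f\circ h^{-1}-\mathrm{id})(x)\bigr|<\varepsilon\qquad\text{for } k=0,1,2.$$ -/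

import Mathlib

noncomputable section

namespace IntervalDiff

/-- A self-map of `[0,1]`, seen as a real function (constant on each side of `[0,1]`; only its
restriction to `[0,1]` is ever used). -/
def real (f : unitInterval → unitInterval) : ℝ → ℝ :=
  Set.IccExtend (zero_le_one' ℝ) (fun x : unitInterval => (f x : ℝ))

/-- `f` is of class `C²` on the closed interval `[0,1]` (one-sided derivatives at the endpoints). -/
def IsC2 (f : unitInterval → unitInterval) : Prop :=
  ContDiffOn ℝ 2 (real f) (Set.Icc 0 1)

theorem real_apply (f : unitInterval → unitInterval) (x : unitInterval) :
    real f (x : ℝ) = (f x : ℝ) :=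
  Set.IccExtend_val _ _ x

theorem isC2_id : IsC2 (fun x => x) := by
  refine (contDiffOn_id (𝕜 := ℝ) (E := ℝ)).congr fun x hx => ?_
  exact real_apply (fun x => x) ⟨x, hx⟩

theorem IsC2.comp {f g : unitInterval → unitInterval} (hf : IsC2 f) (hg : IsC2 g) :
    IsC2 (fun x => f (g x)) := by
  have hmaps : Set.MapsTo (real g) (Set.Icc 0 1) (Set.Icc 0 1) := fun x hx => by
    have h := real_apply g ⟨x, hx⟩
    simp only at h
    rw [h]
    exact (g ⟨x, hx⟩).2
  refine (ContDiffOn.comp hf hg hmaps).congr fun x hx => ?_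
  have h1 := real_apply (fun x => f (g x)) ⟨x, hx⟩
  have h2 := real_apply g ⟨x, hx⟩
  have h3 := real_apply f (g ⟨x, hx⟩)
  simp only [Function.comp_apply] at *
  rw [h1, h2, h3]

end IntervalDiff

open IntervalDiff in
/-- The orientation-preserving (that is, increasing) `C²` diffeomorphisms of `[0,1]`, as a subgroup
of the group of increasing bijections of `[0,1]` under composition. -/
def diffTwoSubgroup : Subgroup (unitInterval ≃o unitInterval) where
  carrier := {f | IsC2 f ∧ IsC2 f.symm}
  one_mem' := ⟨isC2_id, isC2_id⟩
  mul_mem' := fun hf hg => ⟨hf.1.comp hg.1, hg.2.comp hf.2⟩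
  inv_mem' := fun hf => ⟨hf.2, hf.1⟩

/-- The group `Diff²₊([0,1])`. -/
def DiffTwo : Type := diffTwoSubgroup

namespace DiffTwo

instance : Group DiffTwo := inferInstanceAs (Group diffTwoSubgroup)

/-- An element of `Diff²₊([0,1])`, as a real function. -/
def real (f : DiffTwo) : ℝ → ℝ := IntervalDiff.real f.1

/-- The derivatives of order `0`, `1`, `2` of `f` on `[0,1]`, in the space of triples of functions
on `[0,1]` with the topology of uniform convergence. -/
def jet (f : DiffTwo) : Fin 3 → UniformFun unitInterval ℝ := fun k =>
  UniformFun.ofFun fun x => iteratedDerivWithin k f.real (Set.Icc 0 1) x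

/-- The `C²` topology on `Diff²₊([0,1])`: uniform convergence on `[0,1]` of the maps and of their
derivatives of order `1` and `2`. -/
instance c2Topology : TopologicalSpace DiffTwo :=
  TopologicalSpace.induced jet Pi.topologicalSpace

/-- `f` has no fixed point in the open interval `(0,1)`: this is membership in
`Diff²₊^Δ([0,1])`. -/
def NoInteriorFixedPoint (f : DiffTwo) : Prop :=
  ∀ x ∈ Set.Ioo (0 : ℝ) 1, f.real x ≠ x

/-- `p` is a parabolic fixed point of `f`: it is fixed, with (possibly one-sided) derivative `1`. -/
def IsParabolicFixedPoint (f : DiffTwo) (p : ℝ) : Prop :=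
  p ∈ Set.Icc (0 : ℝ) 1 ∧ f.real p = p ∧ derivWithin f.real (Set.Icc 0 1) p = 1

/-- The `C²` centralizer of `f`, a subgroup of `Diff²₊([0,1])`. -/
def c2Centralizer (f : DiffTwo) : Subgroup DiffTwo := Subgroup.centralizer {f}

end DiffTwo

/-- A group is infinite cyclic if it is isomorphic to `ℤ`. -/
def IsInfiniteCyclic (G : Type*) [Group G] : Prop :=
  Nonempty (G ≃* Multiplicative ℤ)

end

noncomputable section

open Set Filter Topology

namespace DiffTwo

/-! ### Diffeomorphisms as real functions -/

variable (f g : DiffTwo)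

/-! Write `nl` for the nonlinearity D log D. Since log Df vanishes somewhere in (0,1), a small
uniform bound on `nl` controls the map and its first two derivatives (`jets_le`). So it suffices to
conjugate f to maps of arbitrarily small nonlinearity (`Flattenable`). Passing to f⁻¹ if necessary,
f moves points up.

Bounded distortion and parabolicity at 0 give, following Szekeres and Kopell, a coordinate γ : ℝ →
(0,1) in which f is the unit translation and its whole centralizer acts by translations
(`exists_flowCoordinate`). Put a = γ' and b = (log a)'. Then nl f(γ s) · a(s) = b(s+1) − b(s), and
the same identity holds for h f h⁻¹ in the coordinate h ∘ γ. If h ∘ γ has derivative 1/(I R), with I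
the constant normalising the length to 1, and if R times the first difference of (log R)' is at most
C in absolute value, then h f h⁻¹ has nonlinearity at most C I.

Take R = P + φ, with P close to 1/a and φ a bump of width S and height S² whose second derivative is
bounded independently of S. Since R ≥ S²/2 for |s| ≤ S/2, the constant I tends to 0 as S grows
(`normalisation_le`). The constant C is uniform in S as soon as ((log P)')² P is bounded near the
support of φ (`exists_second_difference_bound`).

For P = 1/a this would ask for b² = O(a), while parabolicity at both ends controls only unit
increments: (log a(s+1) − log a(s))² = O(a(s)), because (Df − 1)² = O(f − id) for a nonnegative
displacement. Such an increment is the mean of b over [s, s+1], so log a is to be replaced by its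
average over a unit of time. The maps of the flow need not be C², so the average is taken along
powers of an element g of the centralizer. If the centralizer is not infinite cyclic, its
translation lengths are dense in ℝ, so g can have arbitrarily small length t. The average over g^j,
j < ⌊1/t⌋, is then nearly an integral over a unit interval, and log D(g^j) is C¹ up to the
endpoints, so h is a C² diffeomorphism (`exists_conj`). The choices are made in the order C, S, t.
-/

theorem real_coe (x : unitInterval) : f.real (x : ℝ) = f.1 x :=
  IntervalDiff.real_apply _ x

theorem real_mem_Icc (x : ℝ) : f.real x ∈ Icc (0 : ℝ) 1 :=
  (f.1 (projIcc 0 1 zero_le_one x)).2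

theorem real_mul (x : ℝ) : (f * g).real x = f.real (g.real x) := by
  have h := real_coe f (g.1 (projIcc 0 1 zero_le_one x))
  exact h.symm

theorem real_one {x : ℝ} (hx : x ∈ Icc (0 : ℝ) 1) : (1 : DiffTwo).real x = x :=
  real_coe 1 ⟨x, hx⟩

theorem real_inv_real {x : ℝ} (hx : x ∈ Icc (0 : ℝ) 1) : f⁻¹.real (f.real x) = x := by
  rw [← real_mul, inv_mul_cancel, real_one hx]

theorem real_real_inv {x : ℝ} (hx : x ∈ Icc (0 : ℝ) 1) : f.real (f⁻¹.real x) = x := by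
  rw [← real_mul, mul_inv_cancel, real_one hx]

theorem strictMonoOn_real : StrictMonoOn f.real (Icc 0 1) := by
  intro x hx y hy hxy
  have h : f.1 ⟨x, hx⟩ < f.1 ⟨y, hy⟩ := f.1.strictMono hxy
  rw [← Subtype.coe_lt_coe, ← real_coe, ← real_coe] at h
  exact h

theorem real_zero : f.real 0 = 0 := by
  have h := real_coe f 0
  have h2 : f.1 0 = 0 := f.1.map_bot
  rw [h2] at h
  exact h

theorem real_at_one : f.real 1 = 1 := by
  have h := real_coe f 1
  have h2 : f.1 1 = 1 := f.1.map_top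
  rw [h2] at h
  exact h

theorem real_mem_Ioo {x : ℝ} (hx : x ∈ Ioo (0 : ℝ) 1) : f.real x ∈ Ioo (0 : ℝ) 1 := by
  have h0 := f.strictMonoOn_real (left_mem_Icc.2 zero_le_one) (Ioo_subset_Icc_self hx) hx.1
  have h1 := f.strictMonoOn_real (Ioo_subset_Icc_self hx) (right_mem_Icc.2 zero_le_one) hx.2
  rw [real_zero] at h0
  rw [real_at_one] at h1
  exact ⟨h0, h1⟩

theorem real_eq_iff {f g : DiffTwo} (h : ∀ x ∈ Ioo (0 : ℝ) 1, f.real x = g.real x) : f = g := by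
  apply Subtype.ext
  apply OrderIso.ext
  funext x
  apply Subtype.ext
  rw [← real_coe, ← real_coe]
  rcases eq_or_lt_of_le x.2.1 with h0 | h0
  · rw [← h0, real_zero, real_zero]
  rcases eq_or_lt_of_le x.2.2 with h1 | h1
  · rw [h1, real_at_one, real_at_one]
  exact h _ ⟨h0, h1⟩

theorem contDiffOn_real : ContDiffOn ℝ 2 f.real (Icc 0 1) := f.2.1

/-- The first derivative of a diffeomorphism of `[0,1]`. -/
def d1 (x : ℝ) : ℝ := derivWithin f.real (Icc 0 1) x

/-- The second derivative of a diffeomorphism of `[0,1]`. -/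
def d2 (x : ℝ) : ℝ := derivWithin f.d1 (Icc 0 1) x

/-- The nonlinearity (logarithmic derivative of the derivative) of a diffeomorphism. -/
def nl (x : ℝ) : ℝ := f.d2 x / f.d1 x

theorem contDiffOn_d1 : ContDiffOn ℝ 1 f.d1 (Icc 0 1) :=
  f.contDiffOn_real.derivWithin uniqueDiffOn_Icc_zero_one (by norm_num)

theorem continuousOn_d1 : ContinuousOn f.d1 (Icc 0 1) := f.contDiffOn_d1.continuousOn

theorem continuousOn_d2 : ContinuousOn f.d2 (Icc 0 1) :=
  f.contDiffOn_d1.continuousOn_derivWithin uniqueDiffOn_Icc_zero_one le_rfl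

theorem continuousOn_real : ContinuousOn f.real (Icc 0 1) := f.contDiffOn_real.continuousOn

theorem hasDerivWithinAt_real {x : ℝ} (hx : x ∈ Icc (0 : ℝ) 1) :
    HasDerivWithinAt f.real (f.d1 x) (Icc 0 1) x :=
  (f.contDiffOn_real.differentiableOn (by norm_num) x hx).hasDerivWithinAt

theorem hasDerivWithinAt_d1 {x : ℝ} (hx : x ∈ Icc (0 : ℝ) 1) :
    HasDerivWithinAt f.d1 (f.d2 x) (Icc 0 1) x :=
  (f.contDiffOn_d1.differentiableOn (by norm_num) x hx).hasDerivWithinAt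

theorem hasDerivAt_real {x : ℝ} (hx : x ∈ Ioo (0 : ℝ) 1) : HasDerivAt f.real (f.d1 x) x :=
  (f.hasDerivWithinAt_real (Ioo_subset_Icc_self hx)).hasDerivAt (Icc_mem_nhds hx.1 hx.2)

theorem hasDerivAt_d1 {x : ℝ} (hx : x ∈ Ioo (0 : ℝ) 1) : HasDerivAt f.d1 (f.d2 x) x :=
  (f.hasDerivWithinAt_d1 (Ioo_subset_Icc_self hx)).hasDerivAt (Icc_mem_nhds hx.1 hx.2)

theorem d1_mul {x : ℝ} (hx : x ∈ Icc (0 : ℝ) 1) :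
    (f * g).d1 x = f.d1 (g.real x) * g.d1 x := by
  have h := (f.hasDerivWithinAt_real (g.real_mem_Icc x)).comp x (g.hasDerivWithinAt_real hx)
    (fun y _ => g.real_mem_Icc y)
  have h2 : (f * g).real = f.real ∘ g.real := funext fun y => real_mul f g y
  rw [← h2] at h
  exact h.derivWithin (uniqueDiffOn_Icc_zero_one x hx)

theorem d1_one {x : ℝ} (hx : x ∈ Icc (0 : ℝ) 1) : (1 : DiffTwo).d1 x = 1 := by
  have h : HasDerivWithinAt (1 : DiffTwo).real 1 (Icc 0 1) x :=
    (hasDerivWithinAt_id x _).congr (fun y hy => real_one hy) (real_one hx)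
  exact h.derivWithin (uniqueDiffOn_Icc_zero_one x hx)

theorem d1_pos {x : ℝ} (hx : x ∈ Icc (0 : ℝ) 1) : 0 < f.d1 x := by
  have h0 : 0 ≤ f.d1 x := f.strictMonoOn_real.monotoneOn.derivWithin_nonneg
  refine lt_of_le_of_ne h0 fun h => ?_
  have h1 := d1_mul f⁻¹ f hx
  rw [inv_mul_cancel, d1_one hx, ← h, mul_zero] at h1
  exact one_ne_zero h1

theorem d1_inv {x : ℝ} (hx : x ∈ Icc (0 : ℝ) 1) : f⁻¹.d1 (f.real x) = (f.d1 x)⁻¹ := by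
  have h1 := d1_mul f⁻¹ f hx
  rw [inv_mul_cancel, d1_one hx] at h1
  exact eq_inv_of_mul_eq_one_left h1.symm

theorem continuousOn_nl : ContinuousOn f.nl (Icc 0 1) :=
  f.continuousOn_d2.div f.continuousOn_d1 fun _ hx => (f.d1_pos hx).ne'

theorem exists_nl_bound : ∃ C, 0 ≤ C ∧ ∀ x ∈ Icc (0 : ℝ) 1, |f.nl x| ≤ C := by
  obtain ⟨C, hC⟩ := isCompact_Icc.exists_bound_of_continuousOn f.continuousOn_nl
  exact ⟨C, (norm_nonneg _).trans (hC 0 (left_mem_Icc.2 zero_le_one)), hC⟩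

theorem hasDerivAt_log_d1 {x : ℝ} (hx : x ∈ Ioo (0 : ℝ) 1) :
    HasDerivAt (fun y => Real.log (f.d1 y)) (f.nl x) x :=
  (f.hasDerivAt_d1 hx).log (f.d1_pos (Ioo_subset_Icc_self hx)).ne'

theorem nl_mul {x : ℝ} (hx : x ∈ Ioo (0 : ℝ) 1) :
    (f * g).nl x = f.nl (g.real x) * g.d1 x + g.nl x := by
  have h1 := (f * g).hasDerivAt_log_d1 hx
  have h2 := ((f.hasDerivAt_log_d1 (g.real_mem_Ioo hx)).comp x (g.hasDerivAt_real hx)).add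
    (g.hasDerivAt_log_d1 hx)
  refine h1.unique (h2.congr_of_eventuallyEq ?_)
  filter_upwards [Icc_mem_nhds hx.1 hx.2] with y hy
  rw [d1_mul f g hy, Real.log_mul (f.d1_pos (g.real_mem_Icc y)).ne' (g.d1_pos hy).ne']
  rfl

theorem nl_one {x : ℝ} (hx : x ∈ Ioo (0 : ℝ) 1) : (1 : DiffTwo).nl x = 0 := by
  have h := nl_mul 1 1 hx
  rw [mul_one, d1_one (Ioo_subset_Icc_self hx), real_one (Ioo_subset_Icc_self hx)] at h
  linarith

theorem abs_le_on_Icc_of_Ioo {u : ℝ → ℝ} {C : ℝ} (hu : ContinuousOn u (Icc 0 1))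
    (h : ∀ x ∈ Ioo (0 : ℝ) 1, |u x| ≤ C) {x : ℝ} (hx : x ∈ Icc (0 : ℝ) 1) : |u x| ≤ C := by
  have hcl : closure (Ioo (0 : ℝ) 1) = Icc 0 1 := closure_Ioo zero_ne_one
  have := ContinuousWithinAt.closure_le (s := Ioo (0 : ℝ) 1) (f := fun y => |u y|)
    (g := fun _ => C) (x := x) (by rwa [hcl]) ((hu.abs x hx).mono Ioo_subset_Icc_self)
    continuousWithinAt_const (fun y hy => h y hy)
  exact this

/-! ### Small nonlinearity forces closeness to the identity -/

theorem exists_d1_eq_one : ∃ x ∈ Ioo (0 : ℝ) 1, f.d1 x = 1 := by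
  obtain ⟨c, hc, h⟩ := exists_hasDerivAt_eq_slope f.real f.d1 zero_lt_one f.continuousOn_real
    (fun x hx => f.hasDerivAt_real hx)
  refine ⟨c, hc, ?_⟩
  rw [h, real_zero, real_at_one]
  norm_num

/-- log Df vanishes at a mean value point, and its slope is at most ε over an interval of length 1.
-/
theorem abs_log_d1_le {ε : ℝ} (hN : ∀ x ∈ Ioo (0 : ℝ) 1, |f.nl x| ≤ ε) {x : ℝ}
    (hx : x ∈ Icc (0 : ℝ) 1) : |Real.log (f.d1 x)| ≤ ε := by
  have hε : 0 ≤ ε := (abs_nonneg _).trans (hN (1 / 2) (by norm_num))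
  have hcont : ContinuousOn (fun y => Real.log (f.d1 y)) (Icc 0 1) :=
    f.continuousOn_d1.log fun y hy => (f.d1_pos hy).ne'
  obtain ⟨c, hc, h1⟩ := f.exists_d1_eq_one
  refine abs_le_on_Icc_of_Ioo hcont (fun x hx => ?_) hx
  have := (convex_Ioo (0 : ℝ) 1).norm_image_sub_le_of_norm_hasDerivWithin_le
    (fun y hy => (f.hasDerivAt_log_d1 hy).hasDerivWithinAt) hN hc hx
  rw [h1, Real.log_one, sub_zero, Real.norm_eq_abs, Real.norm_eq_abs] at this
  refine this.trans ?_
  have h2 : |x - c| ≤ 1 := abs_le.2 ⟨by linarith [hx.1, hc.2], by linarith [hx.2, hc.1]⟩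
  exact mul_le_of_le_one_right hε h2

theorem jets_le {ε : ℝ} (hε : ε ≤ 1 / 2) (hN : ∀ x ∈ Ioo (0 : ℝ) 1, |f.nl x| ≤ ε) {x : ℝ}
    (hx : x ∈ Icc (0 : ℝ) 1) :
    |f.real x - x| ≤ 2 * ε ∧ |f.d1 x - 1| ≤ 2 * ε ∧ |f.d2 x| ≤ 2 * ε := by
  have hε0 : 0 ≤ ε := (abs_nonneg _).trans (hN (1 / 2) (by norm_num))
  have key : ∀ y ∈ Icc (0 : ℝ) 1, |f.d1 y - 1| ≤ 2 * ε := fun y hy => by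
    have h := f.abs_log_d1_le hN hy
    have h3 := Real.abs_exp_sub_one_le (x := Real.log (f.d1 y)) (by linarith)
    rw [Real.exp_log (f.d1_pos hy)] at h3
    linarith
  refine ⟨?_, key x hx, ?_⟩
  · have := (convex_Icc (0 : ℝ) 1).norm_image_sub_le_of_norm_hasDerivWithin_le
      (f := fun y => f.real y - y) (f' := fun y => f.d1 y - 1) (C := 2 * ε)
      (fun y hy => (f.hasDerivWithinAt_real hy).sub (hasDerivWithinAt_id y _)) key
      (left_mem_Icc.2 zero_le_one) hx
    rw [real_zero, sub_zero, sub_zero, sub_zero, Real.norm_eq_abs, Real.norm_eq_abs,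
      abs_of_nonneg hx.1] at this
    nlinarith [hx.2]
  · have h1 := abs_le_on_Icc_of_Ioo f.continuousOn_nl hN hx
    have h2 := (abs_le.1 (key x hx)).2
    have h4 := f.d1_pos hx
    rw [nl, abs_div, abs_of_pos h4, div_le_iff₀ h4] at h1
    nlinarith

/-- The conjugacy class of `f` contains elements of arbitrarily small nonlinearity. -/
def Flattenable : Prop :=
  ∀ ε > 0, ∃ h : DiffTwo, ∀ x ∈ Ioo (0 : ℝ) 1, |(h * f * h⁻¹).nl x| ≤ ε

-- Differentiating g⁻¹ ∘ g = id gives nl(g⁻¹) ∘ g · Dg = −nl g. As Dg ≥ 1/2, inversion costs at most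
-- a factor 2.
variable {f} in
theorem Flattenable.of_inv (hf : f⁻¹.Flattenable) : f.Flattenable := by
  intro ε hε
  obtain ⟨h, hh⟩ := hf (min (ε / 2) (1 / 2)) (by positivity)
  refine ⟨h, fun x hx => ?_⟩
  set g := h * f⁻¹ * h⁻¹ with hg
  have hinv : h * f * h⁻¹ = g⁻¹ := by rw [hg]; group
  rw [hinv]
  have h1 := nl_mul g⁻¹ g (g⁻¹.real_mem_Ioo hx)
  have hx' := Ioo_subset_Icc_self hx
  have hy := g⁻¹.real_mem_Ioo hx
  rw [inv_mul_cancel, nl_one hy, real_real_inv g hx'] at h1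
  have h2 := (g.jets_le (min_le_right _ _) hh (Ioo_subset_Icc_self hy)).2.1
  have h3 := hh _ hy
  have h4 : min (ε / 2) (1 / 2) ≤ ε / 2 := min_le_left _ _
  have h5 : min (ε / 2) (1 / 2) ≤ 1 / 2 := min_le_right _ _
  have h8 : |g.nl (g⁻¹.real x)| = |g⁻¹.nl x| * g.d1 (g⁻¹.real x) := by
    rw [show g.nl (g⁻¹.real x) = -(g⁻¹.nl x * g.d1 (g⁻¹.real x)) by linarith, abs_neg, abs_mul,
      abs_of_pos (g.d1_pos (Ioo_subset_Icc_self hy))]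
  have h9 := g.abs_log_d1_le hh (Ioo_subset_Icc_self hy)
  have h10 : (1 / 2 : ℝ) ≤ g.d1 (g⁻¹.real x) := by
    have := Real.add_one_le_exp (Real.log (g.d1 (g⁻¹.real x)))
    rw [Real.exp_log (g.d1_pos (Ioo_subset_Icc_self hy))] at this
    linarith [(abs_le.1 h9).1]
  nlinarith [abs_nonneg (g⁻¹.nl x)]

theorem jet_apply_zero (x : unitInterval) : UniformFun.toFun (f.jet 0) x = f.real x := by
  change iteratedDerivWithin 0 f.real (Icc 0 1) x = _
  rw [iteratedDerivWithin_zero]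

theorem jet_apply_one (x : unitInterval) : UniformFun.toFun (f.jet 1) x = f.d1 x := by
  change iteratedDerivWithin 1 f.real (Icc 0 1) x = _
  rw [iteratedDerivWithin_one]
  rfl

theorem jet_apply_two (x : unitInterval) : UniformFun.toFun (f.jet 2) x = f.d2 x := by
  change iteratedDerivWithin 2 f.real (Icc 0 1) x = _
  rw [iteratedDerivWithin_succ]
  exact derivWithin_congr (fun y _ => congrFun iteratedDerivWithin_one y)
    (congrFun iteratedDerivWithin_one _)

theorem d2_one {x : ℝ} (hx : x ∈ Icc (0 : ℝ) 1) : (1 : DiffTwo).d2 x = 0 := by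
  have h : HasDerivWithinAt (1 : DiffTwo).d1 0 (Icc 0 1) x :=
    (hasDerivWithinAt_const x _ (1 : ℝ)).congr (fun y hy => d1_one hy) (d1_one hx)
  exact h.derivWithin (uniqueDiffOn_Icc_zero_one x hx)

variable {f} in
theorem Flattenable.one_mem_closure (hf : f.Flattenable) :
    (1 : DiffTwo) ∈ closure (conjugatesOf f) := by
  -- The factor 1/2 absorbs the 2ε of `jets_le` and keeps the bound below the threshold 1/2 required
  -- there.
  have hpos : ∀ n : ℕ, (0 : ℝ) < 1 / 2 * (1 / ((n : ℝ) + 1)) := fun n => by positivity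
  choose h hh using fun n : ℕ => hf _ (hpos n)
  refine mem_closure_of_tendsto (f := fun n => h n * f * (h n)⁻¹) (b := atTop) ?_
    (Eventually.of_forall fun n => isConj_iff.2 ⟨h n, rfl⟩)
  rw [nhds_induced, tendsto_comap_iff, tendsto_pi_nhds]
  intro k
  rw [UniformFun.tendsto_iff_tendstoUniformly, Metric.tendstoUniformly_iff]
  intro ε hε
  filter_upwards [(tendsto_one_div_add_atTop_nhds_zero_nat (𝕜 := ℝ)).eventually_lt_const hε]
    with n hn x
  have hle : 1 / 2 * (1 / ((n : ℝ) + 1)) ≤ 1 / 2 := by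
    have : 1 / ((n : ℝ) + 1) ≤ 1 := by
      rw [div_le_one (by positivity)]
      linarith [(Nat.cast_nonneg n : (0 : ℝ) ≤ n)]
    linarith
  obtain ⟨j0, j1, j2⟩ := jets_le _ hle (hh n) x.2
  rw [dist_comm, Real.dist_eq]
  fin_cases k
  · change |UniformFun.toFun (jet _ 0) x - UniformFun.toFun (jet 1 0) x| < ε
    rw [jet_apply_zero, jet_apply_zero, real_one x.2]
    linarith
  · change |UniformFun.toFun (jet _ 1) x - UniformFun.toFun (jet 1 1) x| < ε
    rw [jet_apply_one, jet_apply_one, d1_one x.2]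
    linarith
  · change |UniformFun.toFun (jet _ 2) x - UniformFun.toFun (jet 1 2) x| < ε
    rw [jet_apply_two, jet_apply_two, d2_one x.2, sub_zero]
    linarith

end DiffTwo

/-! ### Calculus on the open unit interval -/

theorem eq_of_hasDerivAt_zero_Ioo {u : ℝ → ℝ} (hu : ∀ x ∈ Ioo (0 : ℝ) 1, HasDerivAt u 0 x)
    {x y : ℝ} (hx : x ∈ Ioo (0 : ℝ) 1) (hy : y ∈ Ioo (0 : ℝ) 1) : u x = u y := by
  have := (convex_Ioo (0 : ℝ) 1).norm_image_sub_le_of_norm_hasDerivWithin_le (C := 0)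
    (fun z hz => (hu z hz).hasDerivWithinAt) (fun _ _ => by simp) hy hx
  rw [zero_mul] at this
  exact sub_eq_zero.1 (norm_le_zero_iff.1 this)

theorem exists_primitive_Ioo {u : ℝ → ℝ} (hu : ContinuousOn u (Ioo 0 1)) :
    ∃ U : ℝ → ℝ, ∀ x ∈ Ioo (0 : ℝ) 1, HasDerivAt U (u x) x := by
  refine ⟨fun x => ∫ y in (1 / 2 : ℝ)..x, u y, fun x hx => ?_⟩
  have hhalf : (1 / 2 : ℝ) ∈ Ioo (0 : ℝ) 1 := by norm_num
  refine intervalIntegral.integral_hasDerivAt_right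
    ((hu.mono ((ordConnected_Ioo (a := (0 : ℝ)) (b := 1)).uIcc_subset hhalf hx)).intervalIntegrable)
    ?_ (hu.continuousAt (Ioo_mem_nhds hx.1 hx.2))
  exact hu.stronglyMeasurableAtFilter isOpen_Ioo x hx

namespace DiffTwo

/-! ### Bounded distortion for a contraction -/

/-- `F` moves every interior point towards `0`. -/
def MovesDown (F : DiffTwo) : Prop := ∀ x ∈ Ioo (0 : ℝ) 1, F.real x < x

section Contraction

variable {F : DiffTwo}

theorem pow_succ_real (n : ℕ) (x : ℝ) : (F ^ (n + 1)).real x = (F ^ n).real (F.real x) := by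
  rw [pow_succ, real_mul]

theorem pow_succ_real' (n : ℕ) (x : ℝ) : (F ^ (n + 1)).real x = F.real ((F ^ n).real x) := by
  rw [pow_succ', real_mul]

theorem log_d1_pow {x : ℝ} (hx : x ∈ Icc (0 : ℝ) 1) (n : ℕ) :
    Real.log ((F ^ n).d1 x) = ∑ j ∈ Finset.range n, Real.log (F.d1 ((F ^ j).real x)) := by
  induction n with
  | zero => rw [pow_zero, d1_one hx]; simp
  | succ n ih =>
    rw [pow_succ', d1_mul _ _ hx, Real.log_mul (F.d1_pos (real_mem_Icc _ _)).ne'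
      ((F ^ n).d1_pos hx).ne', ih, Finset.sum_range_succ, add_comm]

/-- Bounded distortion: the j-th terms differ by at most C times the length of [F^(j+1) x, F^j x],
and these lengths telescope to at most 1. -/
theorem abs_log_d1_pow_sub_le {C : ℝ} (hC : 0 ≤ C) (hN : ∀ x ∈ Icc (0 : ℝ) 1, |F.nl x| ≤ C)
    {x y z : ℝ} (hx : x ∈ Ioo (0 : ℝ) 1) (hy : y ∈ Icc (F.real x) x)
    (hz : z ∈ Icc (F.real x) x) (n : ℕ) :
    |Real.log ((F ^ n).d1 y) - Real.log ((F ^ n).d1 z)| ≤ C := by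
  have hIoo : ∀ w ∈ Icc (F.real x) x, w ∈ Ioo (0 : ℝ) 1 := fun w hw =>
    ⟨(F.real_mem_Ioo hx).1.trans_le hw.1, hw.2.trans_lt hx.2⟩
  have hy' := hIoo y hy
  have hz' := hIoo z hz
  rw [log_d1_pow (Ioo_subset_Icc_self hy'), log_d1_pow (Ioo_subset_Icc_self hz'),
    ← Finset.sum_sub_distrib]
  have hstep : ∀ j, |Real.log (F.d1 ((F ^ j).real y)) - Real.log (F.d1 ((F ^ j).real z))| ≤
      C * ((F ^ j).real x - (F ^ (j + 1)).real x) := by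
    intro j
    have hb : ∀ w ∈ Icc (F.real x) x,
        (F ^ (j + 1)).real x ≤ (F ^ j).real w ∧ (F ^ j).real w ≤ (F ^ j).real x := by
      intro w hw
      rw [pow_succ_real]
      have hmono := (F ^ j).strictMonoOn_real.monotoneOn
      exact ⟨hmono (real_mem_Icc _ _) (Ioo_subset_Icc_self (hIoo w hw)) hw.1,
        hmono (Ioo_subset_Icc_self (hIoo w hw)) (Ioo_subset_Icc_self hx) hw.2⟩
    have h1 := (convex_Ioo (0 : ℝ) 1).norm_image_sub_le_of_norm_hasDerivWithin_le
      (fun w hw => (F.hasDerivAt_log_d1 hw).hasDerivWithinAt)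
      (fun w hw => hN w (Ioo_subset_Icc_self hw)) ((F ^ j).real_mem_Ioo hz')
      ((F ^ j).real_mem_Ioo hy')
    refine h1.trans (mul_le_mul_of_nonneg_left ?_ hC)
    have := hb y hy
    have := hb z hz
    exact abs_le.2 ⟨by linarith, by linarith⟩
  refine (Finset.abs_sum_le_sum_abs _ _).trans ((Finset.sum_le_sum fun j _ => hstep j).trans ?_)
  rw [← Finset.mul_sum, Finset.sum_range_sub' (fun j => (F ^ j).real x)]
  have h1 : (F ^ 0).real x ≤ 1 := (real_mem_Icc _ _).2
  have h2 : 0 ≤ (F ^ n).real x := (real_mem_Icc _ _).1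
  exact mul_le_of_le_one_right hC (by linarith)

/-- At a mean value point of the fundamental domain [F x, x] the derivative of F^n is the ratio of
lengths; bounded distortion transfers this to y at the cost of exp C. -/
theorem d1_pow_le {C : ℝ} (hC : 0 ≤ C) (hN : ∀ x ∈ Icc (0 : ℝ) 1, |F.nl x| ≤ C)
    (hF : F.MovesDown) {x y : ℝ} (hx : x ∈ Ioo (0 : ℝ) 1) (hy : y ∈ Icc (F.real x) x) (n : ℕ) :
    (F ^ n).d1 y ≤
      Real.exp C / (x - F.real x) * ((F ^ n).real x - (F ^ (n + 1)).real x) := by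
  have hFx := hF x hx
  obtain ⟨c, hc, h⟩ := exists_hasDerivAt_eq_slope (F ^ n).real (F ^ n).d1 hFx
    ((F ^ n).continuousOn_real.mono (Icc_subset_Icc (F.real_mem_Ioo hx).1.le hx.2.le))
    (fun z hz => (F ^ n).hasDerivAt_real
      ⟨(F.real_mem_Ioo hx).1.trans hz.1, hz.2.trans hx.2⟩)
  rw [← pow_succ_real] at h
  have h1 := (abs_le.1
    (abs_log_d1_pow_sub_le hC hN hx hy (Ioo_subset_Icc_self hc) n)).2
  have hIcc : ∀ w ∈ Icc (F.real x) x, w ∈ Icc (0 : ℝ) 1 := fun w hw =>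
    ⟨(F.real_mem_Ioo hx).1.le.trans hw.1, hw.2.trans hx.2.le⟩
  have hy0 := (F ^ n).d1_pos (hIcc y hy)
  have hc0 := (F ^ n).d1_pos (hIcc c (Ioo_subset_Icc_self hc))
  have h2 : (F ^ n).d1 y ≤ Real.exp C * (F ^ n).d1 c := by
    have := Real.exp_le_exp.2 (sub_le_iff_le_add.1 h1)
    rwa [Real.exp_add, Real.exp_log hy0, Real.exp_log hc0] at this
  rw [h] at h2
  calc _ ≤ _ := h2
    _ = _ := by ring

theorem pow_real_antitone (hF : F.MovesDown) {x : ℝ} (hx : x ∈ Ioo (0 : ℝ) 1) :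
    Antitone fun n => (F ^ n).real x :=
  antitone_nat_of_succ_le fun n => by
    rw [pow_succ_real']
    exact (hF _ ((F ^ n).real_mem_Ioo hx)).le

theorem tendsto_pow_real (hF : F.MovesDown) {x : ℝ} (hx : x ∈ Ioo (0 : ℝ) 1) :
    Tendsto (fun n => (F ^ n).real x) atTop (𝓝 0) := by
  have hbdd : BddBelow (range fun n => (F ^ n).real x) :=
    ⟨0, by rintro _ ⟨n, rfl⟩; exact (real_mem_Icc _ _).1⟩
  have hlim := tendsto_atTop_ciInf (pow_real_antitone hF hx) hbdd
  set L := ⨅ n, (F ^ n).real x with hL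
  have hL0 : 0 ≤ L := ge_of_tendsto' hlim fun n => (real_mem_Icc _ _).1
  have hLx : L ≤ x := by
    have := ciInf_le hbdd 0
    simp only [pow_zero, real_one (Ioo_subset_Icc_self hx)] at this
    exact this
  have hfix : F.real L = L := by
    have h1 : Tendsto (fun n => F.real ((F ^ n).real x)) atTop (𝓝 (F.real L)) :=
      ((F.continuousOn_real L ⟨hL0, hLx.trans hx.2.le⟩).tendsto).comp
        (tendsto_nhdsWithin_iff.2 ⟨hlim, Eventually.of_forall fun n => real_mem_Icc _ _⟩)
    refine tendsto_nhds_unique h1 ?_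
    exact (hlim.comp (tendsto_add_atTop_nat 1)).congr fun n => pow_succ_real' n x
  rcases hL0.eq_or_lt with h | h
  · rwa [← h] at hlim
  · exact absurd hfix (hF L ⟨h, hLx.trans_lt hx.2⟩).ne

/-! ### The nonlinearity of the Fatou coordinate -/

variable (F) in
/-- The sum of the nonlinearities of `F` along its forward orbits, as a solution of
`v = nl F + (v ∘ F) · DF`. -/
def orbitNl (x : ℝ) : ℝ := ∑' n : ℕ, F.nl ((F ^ n).real x) * (F ^ n).d1 x

/-- By `d1_pow_le` the sum telescopes. The factor x in the bound is essential: multiplied by the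
length x − F x, the bound becomes O(x), which kills the integration constant in `exists_fatou`. -/
theorem sum_abs_orbitNl_le {C : ℝ} (hC : 0 ≤ C) (hN : ∀ x ∈ Icc (0 : ℝ) 1, |F.nl x| ≤ C)
    (hF : F.MovesDown) {x y : ℝ} (hx : x ∈ Ioo (0 : ℝ) 1) (hy : y ∈ Icc (F.real x) x) (n : ℕ) :
    ∑ j ∈ Finset.range n, |F.nl ((F ^ j).real y) * (F ^ j).d1 y| ≤
      C * Real.exp C * x / (x - F.real x) := by
  have hFx : 0 < x - F.real x := sub_pos.2 (hF x hx)
  have hyI : y ∈ Icc (0 : ℝ) 1 := ⟨(F.real_mem_Ioo hx).1.le.trans hy.1, hy.2.trans hx.2.le⟩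
  have h : ∀ j ∈ Finset.range n, |F.nl ((F ^ j).real y) * (F ^ j).d1 y| ≤
      C * (Real.exp C / (x - F.real x)) * ((F ^ j).real x - (F ^ (j + 1)).real x) := by
    intro j _
    rw [abs_mul, abs_of_pos ((F ^ j).d1_pos hyI), mul_assoc]
    exact mul_le_mul (hN _ (real_mem_Icc _ _)) (d1_pow_le hC hN hF hx hy j)
      ((F ^ j).d1_pos hyI).le hC
  refine (Finset.sum_le_sum h).trans ?_
  rw [← Finset.mul_sum, Finset.sum_range_sub' (fun j => (F ^ j).real x), pow_zero,
    real_one (Ioo_subset_Icc_self hx)]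
  have h2 : 0 ≤ (F ^ n).real x := (real_mem_Icc _ _).1
  calc C * (Real.exp C / (x - F.real x)) * (x - (F ^ n).real x)
      ≤ C * (Real.exp C / (x - F.real x)) * x :=
        mul_le_mul_of_nonneg_left (by linarith) (by positivity)
    _ = _ := by ring

theorem summable_orbitNl (hF : F.MovesDown) {x : ℝ} (hx : x ∈ Ioo (0 : ℝ) 1) :
    Summable fun n : ℕ => F.nl ((F ^ n).real x) * (F ^ n).d1 x := by
  obtain ⟨C, hC, hN⟩ := F.exists_nl_bound
  exact Summable.of_abs (summable_of_sum_range_le (fun _ => abs_nonneg _)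
    (sum_abs_orbitNl_le hC hN hF hx (right_mem_Icc.2 (hF x hx).le)))

theorem abs_orbitNl_le {C : ℝ} (hC : 0 ≤ C) (hN : ∀ x ∈ Icc (0 : ℝ) 1, |F.nl x| ≤ C)
    (hF : F.MovesDown) {x y : ℝ} (hx : x ∈ Ioo (0 : ℝ) 1) (hy : y ∈ Icc (F.real x) x) :
    |F.orbitNl y| ≤ C * Real.exp C * x / (x - F.real x) := by
  have hs := sum_abs_orbitNl_le hC hN hF hx hy
  generalize hu : (fun n : ℕ => F.nl ((F ^ n).real y) * (F ^ n).d1 y) = u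
  have hs' : ∀ n, ∑ j ∈ Finset.range n, ‖u j‖ ≤ C * Real.exp C * x / (x - F.real x) := by
    rw [← hu]
    exact hs
  have hv : F.orbitNl y = ∑' n, u n := by rw [← hu, orbitNl]
  rw [hv]
  exact (norm_tsum_le_tsum_norm (summable_of_sum_range_le (fun _ => norm_nonneg _) hs')).trans
    (Real.tsum_le_of_sum_range_le (fun _ => norm_nonneg _) hs')

theorem orbitNl_eq (hF : F.MovesDown) {x : ℝ} (hx : x ∈ Ioo (0 : ℝ) 1) :
    F.orbitNl x = F.nl x + F.orbitNl (F.real x) * F.d1 x := by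
  have hxI := Ioo_subset_Icc_self hx
  rw [orbitNl, (summable_orbitNl hF hx).tsum_eq_zero_add, pow_zero, d1_one hxI, real_one hxI,
    mul_one, orbitNl, ← tsum_mul_right]
  congr 1
  refine tsum_congr fun n => ?_
  rw [pow_succ_real, pow_succ, d1_mul _ _ hxI, mul_assoc]

theorem orbitNl_eq_pow (hF : F.MovesDown) {x : ℝ} (hx : x ∈ Ioo (0 : ℝ) 1) (n : ℕ) :
    F.orbitNl x = (F ^ n).nl x + F.orbitNl ((F ^ n).real x) * (F ^ n).d1 x := by
  have hxI := Ioo_subset_Icc_self hx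
  induction n with
  | zero => rw [pow_zero, nl_one hx, d1_one hxI, real_one hxI]; ring
  | succ n ih =>
    rw [ih, orbitNl_eq hF ((F ^ n).real_mem_Ioo hx), pow_succ', nl_mul _ _ hx, d1_mul _ _ hxI,
      real_mul]
    ring

/-- With z = F^n x, the denominator z − F z in the bound of `orbitNl` at z cancels the same length
in `d1_pow_le`, leaving a factor z that tends to 0. -/
theorem abs_orbitNl_tail_le {C : ℝ} (hC : 0 ≤ C) (hN : ∀ x ∈ Icc (0 : ℝ) 1, |F.nl x| ≤ C)
    (hF : F.MovesDown) {x : ℝ} (hx : x ∈ Ioo (0 : ℝ) 1) (n : ℕ) :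
    |F.orbitNl ((F ^ n).real x) * (F ^ n).d1 x| ≤
      C * Real.exp C * Real.exp C / (x - F.real x) * (F ^ n).real x := by
  have hxI := Ioo_subset_Icc_self hx
  have hz := (F ^ n).real_mem_Ioo hx
  have h1 := abs_orbitNl_le hC hN hF hz (right_mem_Icc.2 (hF _ hz).le)
  have h2 := d1_pow_le hC hN hF hx (right_mem_Icc.2 (hF x hx).le) n
  have h3 : 0 < (F ^ n).real x - F.real ((F ^ n).real x) := sub_pos.2 (hF _ hz)
  have h4 : 0 < x - F.real x := sub_pos.2 (hF x hx)
  rw [pow_succ_real'] at h2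
  rw [abs_mul, abs_of_pos ((F ^ n).d1_pos hxI)]
  refine (mul_le_mul h1 h2 ((F ^ n).d1_pos hxI).le
    (by have := hz.1; positivity)).trans (le_of_eq ?_)
  field_simp

theorem tendsto_orbitNl_tail (hF : F.MovesDown) {x : ℝ} (hx : x ∈ Ioo (0 : ℝ) 1) :
    Tendsto (fun n => F.orbitNl ((F ^ n).real x) * (F ^ n).d1 x) atTop (𝓝 0) := by
  obtain ⟨C, hC, hN⟩ := F.exists_nl_bound
  refine squeeze_zero_norm (abs_orbitNl_tail_le hC hN hF hx) ?_
  simpa using (tendsto_pow_real hF hx).const_mul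
    (C * Real.exp C * Real.exp C / (x - F.real x))

theorem tendsto_d1_pow (hF : F.MovesDown) {x : ℝ} (hx : x ∈ Ioo (0 : ℝ) 1) :
    Tendsto (fun n => (F ^ n).d1 x) atTop (𝓝 0) := by
  obtain ⟨C, hC, hN⟩ := F.exists_nl_bound
  refine squeeze_zero (fun n => ((F ^ n).d1_pos (Ioo_subset_Icc_self hx)).le)
    (d1_pow_le hC hN hF hx (right_mem_Icc.2 (hF x hx).le)) ?_
  have h := tendsto_pow_real hF hx
  simpa using (h.sub (h.comp (tendsto_add_atTop_nat 1))).const_mul (Real.exp C / (x - F.real x))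

/-- On compact subintervals of (0,1) the displacement is bounded below, so by the tail estimate
`orbitNl` is the uniform limit of the continuous functions `nl (F ^ n)`. -/
theorem continuousOn_orbitNl (hF : F.MovesDown) : ContinuousOn F.orbitNl (Ioo 0 1) := by
  obtain ⟨C, hC, hN⟩ := F.exists_nl_bound
  have hloc : ∀ p q : ℝ, 0 < q → p < 1 → q < p → ContinuousOn F.orbitNl (Icc q p) := by
    intro p q hq hp hqp
    have hsub : Icc q p ⊆ Ioo 0 1 := fun z hz => ⟨hq.trans_le hz.1, hz.2.trans_lt hp⟩
    have hpI : p ∈ Ioo (0 : ℝ) 1 := ⟨hq.trans hqp, hp⟩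
    obtain ⟨z₀, hz₀, hmin⟩ := isCompact_Icc.exists_isMinOn (nonempty_Icc.2 hqp.le)
      (f := fun z => z - F.real z)
      (continuousOn_id.sub (F.continuousOn_real.mono (hsub.trans Ioo_subset_Icc_self)))
    have hδ : 0 < z₀ - F.real z₀ := sub_pos.2 (hF z₀ (hsub hz₀))
    have hunif : TendstoUniformlyOn (fun n => (F ^ n).nl) F.orbitNl atTop (Icc q p) := by
      have hlim : Tendsto (fun n => C * Real.exp C * Real.exp C / (z₀ - F.real z₀) *
          (F ^ n).real p) atTop (𝓝 0) := by
        simpa using (tendsto_pow_real hF hpI).const_mul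
          (C * Real.exp C * Real.exp C / (z₀ - F.real z₀))
      rw [Metric.tendstoUniformlyOn_iff]
      intro ε hε
      filter_upwards [hlim.eventually_lt_const hε] with n hn z hz
      rw [orbitNl_eq_pow hF (hsub hz) n, Real.dist_eq, add_sub_cancel_left]
      refine lt_of_le_of_lt ?_ hn
      refine (abs_orbitNl_tail_le hC hN hF (hsub hz) n).trans ?_
      have h1 : z₀ - F.real z₀ ≤ z - F.real z := hmin hz
      have h2 : (F ^ n).real z ≤ (F ^ n).real p := (F ^ n).strictMonoOn_real.monotoneOn
        (Ioo_subset_Icc_self (hsub hz)) (Ioo_subset_Icc_self hpI) hz.2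
      have h3 : 0 ≤ (F ^ n).real z := (real_mem_Icc _ _).1
      gcongr
    exact hunif.continuousOn (Eventually.of_forall fun n =>
      (F ^ n).continuousOn_nl.mono (hsub.trans Ioo_subset_Icc_self)).frequently
  intro x hx
  refine ((hloc ((x + 1) / 2) (x / 2) (by linarith [hx.1]) (by linarith [hx.2])
    (by linarith)).continuousAt (Icc_mem_nhds ?_ ?_)).continuousWithinAt
  · linarith [hx.1]
  · linarith [hx.2]

/-- Expanding the nonlinearity of F^n g = g F^n in both ways writes the defect through tails of
`orbitNl` and a term carrying DF^n, all of which tend to 0. -/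
theorem orbitNl_commute (hF : F.MovesDown) {g : DiffTwo} (hg : Commute g F) {x : ℝ}
    (hx : x ∈ Ioo (0 : ℝ) 1) : F.orbitNl (g.real x) * g.d1 x + g.nl x = F.orbitNl x := by
  have hxI := Ioo_subset_Icc_self hx
  have key : ∀ n : ℕ, F.orbitNl (g.real x) * g.d1 x + g.nl x - F.orbitNl x =
      g.nl ((F ^ n).real x) * (F ^ n).d1 x - F.orbitNl ((F ^ n).real x) * (F ^ n).d1 x +
        F.orbitNl ((F ^ n).real (g.real x)) * (F ^ n).d1 (g.real x) * g.d1 x := by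
    intro n
    have h1 := nl_mul (F ^ n) g hx
    rw [← (hg.pow_right n).eq, nl_mul _ _ hx] at h1
    rw [orbitNl_eq_pow hF hx n, orbitNl_eq_pow hF (g.real_mem_Ioo hx) n]
    linear_combination -h1
  obtain ⟨C, hC, hN⟩ := g.exists_nl_bound
  have l1 : Tendsto (fun n => g.nl ((F ^ n).real x) * (F ^ n).d1 x) atTop (𝓝 0) := by
    refine squeeze_zero_norm (a := fun n => C * (F ^ n).d1 x) (fun n => ?_)
      (by simpa using (tendsto_d1_pow hF hx).const_mul C)
    rw [norm_mul, Real.norm_eq_abs, Real.norm_eq_abs, abs_of_pos ((F ^ n).d1_pos hxI)]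
    exact mul_le_mul_of_nonneg_right (hN _ (real_mem_Icc _ _)) ((F ^ n).d1_pos hxI).le
  have l2 := (l1.sub (tendsto_orbitNl_tail hF hx)).add
    ((tendsto_orbitNl_tail hF (g.real_mem_Ioo hx)).mul_const (g.d1 x))
  have l3 := l2.congr fun n => (key n).symm
  have := tendsto_nhds_unique tendsto_const_nhds l3
  linarith

end Contraction

end DiffTwo

namespace DiffTwo

/-! ### The Fatou coordinate -/

/-- Let τ' = exp V with V' = `orbitNl`. The equation solved by `orbitNl` makes the logarithm of (τ'
∘ F) · DF / τ' constant; once this constant is 0, τ ∘ F − τ is constant as well, and rescaling τ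
makes it −1. -/
theorem exists_fatou {F : DiffTwo} (hF : F.MovesDown) (hF0 : F.d1 0 = 1) :
    ∃ τ V : ℝ → ℝ, (∀ x ∈ Ioo (0 : ℝ) 1, HasDerivAt τ (Real.exp (V x)) x) ∧
      (∀ x ∈ Ioo (0 : ℝ) 1, HasDerivAt V (F.orbitNl x) x) ∧
      ∀ x ∈ Ioo (0 : ℝ) 1, τ (F.real x) = τ x - 1 := by
  obtain ⟨U, hU⟩ := exists_primitive_Ioo (continuousOn_orbitNl hF)
  have hUc : ContinuousOn U (Ioo 0 1) := fun x hx => (hU x hx).continuousAt.continuousWithinAt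
  obtain ⟨τ, hτ⟩ := exists_primitive_Ioo (u := fun x => Real.exp (U x)) hUc.rexp
  have hhalf : (1 / 2 : ℝ) ∈ Ioo (0 : ℝ) 1 := by norm_num
  -- `U (F x) + log (DF x) - U x` is constant, and it vanishes because `0` is parabolic
  have hW : ∀ x ∈ Ioo (0 : ℝ) 1, U (F.real x) + Real.log (F.d1 x) - U x = 0 := by
    have hconst : ∀ x ∈ Ioo (0 : ℝ) 1,
        HasDerivAt (fun x => U (F.real x) + Real.log (F.d1 x) - U x) 0 x := by
      intro x hx
      have h := (((hU _ (F.real_mem_Ioo hx)).comp x (F.hasDerivAt_real hx)).add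
        (F.hasDerivAt_log_d1 hx)).sub (hU x hx)
      have h0 := orbitNl_eq hF hx
      rw [show F.orbitNl (F.real x) * F.d1 x + F.nl x - F.orbitNl x = 0 by linarith] at h
      exact h
    obtain ⟨C, hC, hN⟩ := F.exists_nl_bound
    -- U varies by O(z) over [F z, z], and log DF(z) tends to log DF(0) = 0; letting z tend to 0
    -- shows that the constant is 0.
    have hbd : ∀ z ∈ Ioo (0 : ℝ) 1, |U (F.real z) + Real.log (F.d1 z) - U z| ≤
        C * Real.exp C * z + |Real.log (F.d1 z)| := by
      intro z hz
      have hsub : Icc (F.real z) z ⊆ Ioo 0 1 := fun w hw =>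
        ⟨(F.real_mem_Ioo hz).1.trans_le hw.1, hw.2.trans_lt hz.2⟩
      have h1 := (convex_Icc (F.real z) z).norm_image_sub_le_of_norm_hasDerivWithin_le
        (fun w hw => (hU w (hsub hw)).hasDerivWithinAt)
        (fun w hw => abs_orbitNl_le hC hN hF hz hw)
        (right_mem_Icc.2 (hF z hz).le) (left_mem_Icc.2 (hF z hz).le)
      have hpos : 0 < z - F.real z := sub_pos.2 (hF z hz)
      rw [Real.norm_eq_abs, Real.norm_eq_abs, abs_sub_comm (F.real z), abs_of_pos hpos,
        div_mul_cancel₀ _ hpos.ne'] at h1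
      calc _ = |(U (F.real z) - U z) + Real.log (F.d1 z)| := by congr 1; ring
        _ ≤ _ := abs_add_le _ _
        _ ≤ _ := by gcongr
    intro x hx
    have hlim : Tendsto (fun z => C * Real.exp C * z + |Real.log (F.d1 z)|)
        (𝓝[Ioo 0 1] (0 : ℝ)) (𝓝 0) := by
      have h0 : (0 : ℝ) ∈ Icc (0 : ℝ) 1 := left_mem_Icc.2 zero_le_one
      have h1 : Tendsto F.d1 (𝓝[Ioo 0 1] (0 : ℝ)) (𝓝 1) := by
        have := (F.continuousOn_d1 0 h0).tendsto
        rw [hF0] at this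
        exact this.mono_left (nhdsWithin_mono _ Ioo_subset_Icc_self)
      have h2 := (h1.log one_ne_zero).abs
      have h3 : Tendsto (fun z : ℝ => z) (𝓝[Ioo 0 1] (0 : ℝ)) (𝓝 0) :=
        tendsto_id.mono_left nhdsWithin_le_nhds
      simpa using (h3.const_mul (C * Real.exp C)).add h2
    have hne : (𝓝[Ioo 0 1] (0 : ℝ)).NeBot := by
      rw [← mem_closure_iff_nhdsWithin_neBot, closure_Ioo zero_ne_one]
      exact left_mem_Icc.2 zero_le_one
    have hle := ge_of_tendsto hlim (b := |U (F.real x) + Real.log (F.d1 x) - U x|) (by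
      filter_upwards [self_mem_nhdsWithin] with z hz
      rw [eq_of_hasDerivAt_zero_Ioo hconst hx hz]
      exact hbd z hz)
    exact abs_nonpos_iff.1 hle
  have hconst : ∀ x ∈ Ioo (0 : ℝ) 1, HasDerivAt (fun x => τ (F.real x) - τ x) 0 x := by
    intro x hx
    have h := ((hτ _ (F.real_mem_Ioo hx)).comp x (F.hasDerivAt_real hx)).sub (hτ x hx)
    have hd := F.d1_pos (Ioo_subset_Icc_self hx)
    have h0 : U x = U (F.real x) + Real.log (F.d1 x) := by linarith [hW x hx]
    rw [h0, Real.exp_add, Real.exp_log hd, sub_self] at h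
    exact h
  set k := τ (1 / 2) - τ (F.real (1 / 2)) with hk
  have hkpos : 0 < k := by
    have hsub : Icc (F.real (1 / 2)) (1 / 2) ⊆ Ioo 0 1 := fun w hw =>
      ⟨(F.real_mem_Ioo hhalf).1.trans_le hw.1, hw.2.trans_lt hhalf.2⟩
    obtain ⟨c, hc, h⟩ := exists_hasDerivAt_eq_slope τ (fun x => Real.exp (U x)) (hF _ hhalf)
      (fun z hz => (hτ z (hsub hz)).continuousAt.continuousWithinAt)
      (fun z hz => hτ z (hsub (Ioo_subset_Icc_self hz)))
    have h1 : 0 < (1 / 2 : ℝ) - F.real (1 / 2) := sub_pos.2 (hF _ hhalf)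
    have h2 := Real.exp_pos (U c)
    rw [h] at h2
    exact (div_pos_iff_of_pos_right h1).1 h2
  refine ⟨fun x => τ x / k, fun x => U x - Real.log k, fun x hx => ?_,
    fun x hx => (hU x hx).sub_const _, fun x hx => ?_⟩
  · rw [Real.exp_sub, Real.exp_log hkpos]
    exact (hτ x hx).div_const k
  · have := eq_of_hasDerivAt_zero_Ioo hconst hx hhalf
    have h1 : τ (F.real x) = τ x - k := by linarith
    change τ (F.real x) / k = τ x / k - 1
    rw [h1, sub_div, div_self hkpos.ne']

/-- A diffeomorphism commuting with `F` is a translation in the Fatou coordinate of `F`. -/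
theorem exists_translation {F : DiffTwo} (hF : F.MovesDown) {τ V : ℝ → ℝ}
    (hτ : ∀ x ∈ Ioo (0 : ℝ) 1, HasDerivAt τ (Real.exp (V x)) x)
    (hV : ∀ x ∈ Ioo (0 : ℝ) 1, HasDerivAt V (F.orbitNl x) x)
    (hshift : ∀ x ∈ Ioo (0 : ℝ) 1, τ (F.real x) = τ x - 1) {g : DiffTwo} (hg : Commute g F) :
    ∃ t, ∀ x ∈ Ioo (0 : ℝ) 1, τ (g.real x) = τ x + t := by
  have hhalf : (1 / 2 : ℝ) ∈ Ioo (0 : ℝ) 1 := by norm_num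
  have h1 : ∀ x ∈ Ioo (0 : ℝ) 1,
      HasDerivAt (fun x => V (g.real x) + Real.log (g.d1 x) - V x) 0 x := by
    intro x hx
    have h := (((hV _ (g.real_mem_Ioo hx)).comp x (g.hasDerivAt_real hx)).add
      (g.hasDerivAt_log_d1 hx)).sub (hV x hx)
    rwa [orbitNl_commute hF hg hx, sub_self] at h
  set c := V (g.real (1 / 2)) + Real.log (g.d1 (1 / 2)) - V (1 / 2) with hc
  have h2 : ∀ x ∈ Ioo (0 : ℝ) 1,
      HasDerivAt (fun x => τ (g.real x) - Real.exp c * τ x) 0 x := by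
    intro x hx
    have h := ((hτ _ (g.real_mem_Ioo hx)).comp x (g.hasDerivAt_real hx)).sub
      ((hτ x hx).const_mul (Real.exp c))
    have h3 : V (g.real x) + Real.log (g.d1 x) - V x = c :=
      eq_of_hasDerivAt_zero_Ioo h1 hx hhalf
    have h4 : Real.exp c * Real.exp (V x) = Real.exp (V (g.real x)) * g.d1 x := by
      rw [← Real.exp_add, ← h3, sub_add_cancel, Real.exp_add,
        Real.exp_log (g.d1_pos (Ioo_subset_Icc_self hx))]
    rwa [h4, sub_self] at h
  set t := τ (g.real (1 / 2)) - Real.exp c * τ (1 / 2) with ht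
  have h3 : ∀ x ∈ Ioo (0 : ℝ) 1, τ (g.real x) - Real.exp c * τ x = t := fun x hx =>
    eq_of_hasDerivAt_zero_Ioo h2 hx hhalf
  -- So far τ ∘ g = e^c τ + t. Commutation with F, which lowers τ by 1, forces e^c = 1.
  have h4 := h3 _ (F.real_mem_Ioo hhalf)
  rw [hshift _ hhalf, ← real_mul, hg.eq, real_mul, hshift _ (g.real_mem_Ioo hhalf)] at h4
  have h5 : Real.exp c = 1 := by linarith [h3 _ hhalf]
  refine ⟨t, fun x hx => ?_⟩
  have := h3 x hx
  rw [h5] at this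
  linarith

end DiffTwo

/-! ### Flow coordinates -/

/-- A `C²` diffeomorphism `γ : ℝ → (0,1)` with positive derivative `a`, and `b = (log a)'`. -/
structure IsFlowCoordinate (γ a b : ℝ → ℝ) : Prop where
  mem : ∀ s, γ s ∈ Ioo (0 : ℝ) 1
  surj : ∀ x ∈ Ioo (0 : ℝ) 1, ∃ s, γ s = x
  pos : ∀ s, 0 < a s
  hasDerivAt : ∀ s, HasDerivAt γ (a s) s
  hasDerivAt_log : ∀ s, HasDerivAt (fun s => Real.log (a s)) (b s) s
  cont : Continuous b

namespace DiffTwo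

/-- γ is the inverse of the Fatou coordinate of the contraction f⁻¹, which is onto ℝ because it
takes the values τ(1/2) ± n along the orbit of 1/2. Only parabolicity at 0 enters. -/
theorem exists_flowCoordinate {f : DiffTwo} (hf : f⁻¹.MovesDown) (hf0 : f⁻¹.d1 0 = 1) :
    ∃ γ a b, IsFlowCoordinate γ a b ∧ (∀ s, f.real (γ s) = γ (s + 1)) ∧
      ∀ g, Commute g f → ∃ t, ∀ s, g.real (γ s) = γ (s + t) := by
  obtain ⟨τ, V, hτ, hV, hshift⟩ := exists_fatou hf hf0
  have hcont : ContinuousOn τ (Ioo 0 1) := fun x hx => (hτ x hx).continuousAt.continuousWithinAt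
  have hmono : StrictMonoOn τ (Ioo 0 1) := by
    refine strictMonoOn_of_deriv_pos (convex_Ioo 0 1) hcont fun x hx => ?_
    rw [interior_Ioo] at hx
    rw [(hτ x hx).deriv]
    exact Real.exp_pos _
  have hup : ∀ x ∈ Ioo (0 : ℝ) 1, τ (f.real x) = τ x + 1 := fun x hx => by
    have := hshift _ (f.real_mem_Ioo hx)
    rw [real_inv_real f (Ioo_subset_Icc_self hx)] at this
    linarith
  have hhalf : (1 / 2 : ℝ) ∈ Ioo (0 : ℝ) 1 := by norm_num
  have hdn' : ∀ n : ℕ, τ ((f⁻¹ ^ n).real (1 / 2)) = τ (1 / 2) - n := by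
    intro n
    induction n with
    | zero => rw [pow_zero, real_one (Ioo_subset_Icc_self hhalf)]; simp
    | succ n ih =>
      rw [pow_succ_real', hshift _ ((f⁻¹ ^ n).real_mem_Ioo hhalf), ih]
      push_cast
      ring
  have hup' : ∀ n : ℕ, τ ((f ^ n).real (1 / 2)) = τ (1 / 2) + n := by
    intro n
    induction n with
    | zero => rw [pow_zero, real_one (Ioo_subset_Icc_self hhalf)]; simp
    | succ n ih =>
      rw [pow_succ_real', hup _ ((f ^ n).real_mem_Ioo hhalf), ih]
      push_cast
      ring
  have hsurj : ∀ s, ∃ x ∈ Ioo (0 : ℝ) 1, τ x = s := by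
    intro s
    obtain ⟨n, hn⟩ := exists_nat_ge |s - τ (1 / 2)|
    have h := isPreconnected_Ioo.intermediate_value ((f⁻¹ ^ n).real_mem_Ioo hhalf)
      ((f ^ n).real_mem_Ioo hhalf) hcont
    rw [hdn', hup'] at h
    have := abs_le.1 hn
    exact h ⟨by linarith, by linarith⟩
  let e : Ioo (0 : ℝ) 1 ≃o ℝ := StrictMono.orderIsoOfSurjective (fun x : Ioo (0 : ℝ) 1 => τ x)
    (fun x y hxy => hmono x.2 y.2 hxy) (fun s => by
      obtain ⟨x, hx, h⟩ := hsurj s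
      exact ⟨⟨x, hx⟩, h⟩)
  have hinj : ∀ x ∈ Ioo (0 : ℝ) 1, ((e.symm (τ x) : Ioo (0 : ℝ) 1) : ℝ) = x := fun x hx => by
    have : e ⟨x, hx⟩ = τ x := rfl
    rw [← this, e.symm_apply_apply]
  have hright : ∀ s, τ (e.symm s : Ioo (0 : ℝ) 1) = s := fun s => e.apply_symm_apply s
  have hec : Continuous fun s => ((e.symm s : Ioo (0 : ℝ) 1) : ℝ) :=
    continuous_subtype_val.comp e.symm.continuous
  have hd : ∀ s, HasDerivAt (fun s => ((e.symm s : Ioo (0 : ℝ) 1) : ℝ))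
      (Real.exp (-V (e.symm s : Ioo (0 : ℝ) 1))) s := fun s => by
    rw [Real.exp_neg]
    exact HasDerivAt.of_local_left_inverse hec.continuousAt (hτ _ (e.symm s).2)
      (Real.exp_pos _).ne' (Eventually.of_forall hright)
  have htrans : ∀ (g : DiffTwo) (t : ℝ), (∀ x ∈ Ioo (0 : ℝ) 1, τ (g.real x) = τ x + t) →
      ∀ s, g.real (e.symm s : Ioo (0 : ℝ) 1) = (e.symm (s + t) : Ioo (0 : ℝ) 1) := by
    intro g t h s
    have h1 := h _ (e.symm s).2
    rw [hright] at h1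
    rw [← h1, hinj _ (g.real_mem_Ioo (e.symm s).2)]
  refine ⟨fun s => (e.symm s : Ioo (0 : ℝ) 1), fun s => Real.exp (-V (e.symm s : Ioo (0 : ℝ) 1)),
    fun s => -(f⁻¹.orbitNl (e.symm s : Ioo (0 : ℝ) 1) *
      Real.exp (-V (e.symm s : Ioo (0 : ℝ) 1))), ⟨fun s => (e.symm s).2,
      fun x hx => ⟨τ x, hinj x hx⟩, fun s => Real.exp_pos _, hd, fun s => ?_, ?_⟩,
    htrans f 1 hup, fun g hg => ?_⟩
  · simp only [Real.log_exp]
    exact ((hV _ (e.symm s).2).comp s (hd s)).neg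
  · have hVc : ContinuousOn V (Ioo 0 1) := fun x hx => (hV x hx).continuousAt.continuousWithinAt
    exact (((continuousOn_orbitNl hf).comp_continuous hec fun s => (e.symm s).2).mul
      (hVc.comp_continuous hec fun s => (e.symm s).2).neg.rexp).neg
  · obtain ⟨t, ht⟩ := exists_translation hf hτ hV hshift hg.inv_right
    exact ⟨t, htrans g t ht⟩

end DiffTwo

namespace IsFlowCoordinate

variable {γ a b : ℝ → ℝ}

theorem strictMono (hγ : IsFlowCoordinate γ a b) : StrictMono γ :=
  strictMono_of_deriv_pos fun s => by
    rw [(hγ.hasDerivAt s).deriv]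
    exact hγ.pos s

theorem continuous (hγ : IsFlowCoordinate γ a b) : Continuous γ :=
  continuous_iff_continuousAt.2 fun s => (hγ.hasDerivAt s).continuousAt

theorem eq_of_shift (hγ : IsFlowCoordinate γ a b) {g : DiffTwo} {t t' : ℝ} (h : ∀ s, g.real (γ s) = γ (s + t))
    (h' : ∀ s, g.real (γ s) = γ (s + t')) : t = t' := by
  have := hγ.strictMono.injective ((h 0).symm.trans (h' 0))
  simpa using this

theorem eq_of_same_shift (hγ : IsFlowCoordinate γ a b) {g g' : DiffTwo} {t : ℝ} (h : ∀ s, g.real (γ s) = γ (s + t))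
    (h' : ∀ s, g'.real (γ s) = γ (s + t)) : g = g' := by
  refine DiffTwo.real_eq_iff fun x hx => ?_
  obtain ⟨s, rfl⟩ := hγ.surj x hx
  rw [h, h']

/-- If the centralizer acts by translations in a flow coordinate and is not infinite cyclic, then
the translation lengths are dense. -/
theorem exists_small_shift (hγ : IsFlowCoordinate γ a b) {f : DiffTwo}
    (hf : ∀ s, f.real (γ s) = γ (s + 1))
    (hcomm : ∀ g, Commute g f → ∃ t, ∀ s, g.real (γ s) = γ (s + t))
    (hcent : ¬ IsInfiniteCyclic f.c2Centralizer) {δ : ℝ} (hδ : 0 < δ) :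
    ∃ (g : DiffTwo) (t : ℝ), 0 < t ∧ t < δ ∧ ∀ s, g.real (γ s) = γ (s + t) := by
  have hmem : ∀ g : f.c2Centralizer, Commute (g : DiffTwo) f := fun g =>
    (Subgroup.mem_centralizer_singleton_iff.1 g.2)
  choose T hT using fun g : f.c2Centralizer => hcomm g (hmem g)
  have hmul : ∀ g g' : f.c2Centralizer, T (g * g') = T g + T g' := fun g g' =>
    hγ.eq_of_shift (hT (g * g')) fun s => by
      rw [Subgroup.coe_mul, DiffTwo.real_mul, hT, hT]
      congr 1
      ring
  let φ : f.c2Centralizer →* Multiplicative ℝ :=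
    MonoidHom.mk' (fun g => Multiplicative.ofAdd (T g)) fun g g' => by rw [hmul]; rfl
  have hφinj : Function.Injective φ := fun g g' h => by
    have h' : T g = T g' := h
    exact Subtype.ext (hγ.eq_of_same_shift (hT g) (by rw [h']; exact hT g'))
  let S : AddSubgroup ℝ := Subgroup.toAddSubgroup' φ.range
  have hS : ∀ t, t ∈ S ↔ ∃ g, T g = t := fun t => Iff.rfl
  have h1S : (1 : ℝ) ∈ S := by
    let f' : f.c2Centralizer := ⟨f, Subgroup.mem_centralizer_singleton_iff.2 rfl⟩
    exact (hS 1).2 ⟨f', hγ.eq_of_shift (hT f') hf⟩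
  -- The centralizer embeds in ℝ with image S. If S were cyclic, it would be infinite cyclic, since
  -- it contains the length 1 of f.
  rcases S.dense_or_cyclic with hd | ⟨t₀, ht₀⟩
  · obtain ⟨t, htS, ht⟩ := hd.exists_between hδ
    obtain ⟨g, rfl⟩ := (hS t).1 htS
    exact ⟨g, T g, ht.1, ht.2, hT g⟩
  · exfalso
    have hcyc : ∀ t, t ∈ S ↔ ∃ n : ℤ, n • t₀ = t := fun t => by
      rw [ht₀, AddSubgroup.mem_closure_singleton]
    obtain ⟨n₁, hn₁⟩ := (hcyc 1).1 h1S
    have ht₀0 : t₀ ≠ 0 := by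
      rintro rfl
      simp at hn₁
    obtain ⟨g₀, hg₀⟩ := (hS t₀).1 ((hcyc t₀).2 ⟨1, one_zsmul _⟩)
    have hpow : ∀ n : ℤ, T (g₀ ^ n) = n • t₀ := fun n => by
      have h := map_zpow φ g₀ n
      have h2 : T (g₀ ^ n) = n • T g₀ := h
      rw [h2, hg₀]
    refine hcent ⟨(MulEquiv.ofBijective (zpowersHom _ g₀) ⟨fun m n hmn => ?_, fun g => ?_⟩).symm⟩
    · have h : T (g₀ ^ m.toAdd) = T (g₀ ^ n.toAdd) := congrArg T hmn
      rw [hpow, hpow] at h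
      exact smul_left_injective ℤ ht₀0 h
    · obtain ⟨n, hn⟩ := (hcyc (T g)).1 ((hS _).2 ⟨g, rfl⟩)
      refine ⟨Multiplicative.ofAdd n, hφinj ?_⟩
      change T (g₀ ^ n) = T g
      rw [hpow, hn]

end IsFlowCoordinate

/-! ### Distortion in a flow coordinate -/

theorem abs_sub_le_of_hasDerivAt {u u' : ℝ → ℝ} {K : ℝ} (hu : ∀ s, HasDerivAt u (u' s) s)
    {x y : ℝ} (hK : ∀ s ∈ uIcc x y, |u' s| ≤ K) : |u y - u x| ≤ K * |y - x| :=
  (convex_uIcc x y).norm_image_sub_le_of_norm_hasDerivWithin_le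
    (fun s _ => (hu s).hasDerivWithinAt) hK left_mem_uIcc right_mem_uIcc

namespace IsFlowCoordinate

variable {γ a b : ℝ → ℝ}

theorem mem_Icc (hγ : IsFlowCoordinate γ a b) (s : ℝ) : γ s ∈ Icc (0 : ℝ) 1 :=
  Ioo_subset_Icc_self (hγ.mem s)

theorem d1_eq (hγ : IsFlowCoordinate γ a b) {g : DiffTwo} {t : ℝ}
    (hg : ∀ s, g.real (γ s) = γ (s + t)) (s : ℝ) : g.d1 (γ s) = a (s + t) / a s := by
  have h1 := (g.hasDerivAt_real (hγ.mem s)).comp s (hγ.hasDerivAt s)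
  have h2 : g.real ∘ γ = fun s => γ (s + t) := funext hg
  rw [h2] at h1
  have h3 := h1.unique ((hγ.hasDerivAt (s + t)).comp_add_const s t)
  exact eq_div_of_mul_eq (hγ.pos s).ne' h3

theorem log_d1_eq (hγ : IsFlowCoordinate γ a b) {g : DiffTwo} {t : ℝ}
    (hg : ∀ s, g.real (γ s) = γ (s + t)) (s : ℝ) :
    Real.log (g.d1 (γ s)) = Real.log (a (s + t)) - Real.log (a s) := by
  rw [hγ.d1_eq hg, Real.log_div (hγ.pos _).ne' (hγ.pos _).ne']

/-- This is the derivative of log Dg(γ s) = log a(s+t) − log a(s). It turns nonlinearity into a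
first difference of b, for f and later for its conjugates. -/
theorem nl_mul_eq (hγ : IsFlowCoordinate γ a b) {g : DiffTwo} {t : ℝ}
    (hg : ∀ s, g.real (γ s) = γ (s + t)) (s : ℝ) : g.nl (γ s) * a s = b (s + t) - b s := by
  have h1 := (g.hasDerivAt_log_d1 (hγ.mem s)).comp s (hγ.hasDerivAt s)
  have h2 : (fun y => Real.log (g.d1 y)) ∘ γ =
      fun s => Real.log (a (s + t)) - Real.log (a s) := funext (hγ.log_d1_eq hg)
  rw [h2] at h1
  exact h1.unique (((hγ.hasDerivAt_log (s + t)).comp_add_const s t).sub (hγ.hasDerivAt_log s))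

variable {f : DiffTwo}

theorem abs_shift_sub_le (hγ : IsFlowCoordinate γ a b) (hf : ∀ s, f.real (γ s) = γ (s + 1))
    {C : ℝ} (hN : ∀ x ∈ Icc (0 : ℝ) 1, |f.nl x| ≤ C) (s : ℝ) :
    |b (s + 1) - b s| ≤ C * a s := by
  rw [← hγ.nl_mul_eq hf, abs_mul, abs_of_pos (hγ.pos s)]
  exact mul_le_mul_of_nonneg_right (hN _ (hγ.mem_Icc s)) (hγ.pos s).le

/-- Bounded distortion in the coordinate: the consecutive intervals from γ(s₀+j) to γ(s₀+j+1) have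
total length at most 1. -/
theorem abs_log_shift_sub_le (hγ : IsFlowCoordinate γ a b)
    (hf : ∀ s, f.real (γ s) = γ (s + 1)) {C : ℝ} (hC : 0 ≤ C)
    (hN : ∀ x ∈ Icc (0 : ℝ) 1, |f.nl x| ≤ C) (s₀ : ℝ) {r : ℝ} (hr : r ∈ Icc (0 : ℝ) 1) (n : ℕ) :
    |(Real.log (a (s₀ + r + n)) - Real.log (a (s₀ + r))) -
      (Real.log (a (s₀ + n)) - Real.log (a s₀))| ≤ C := by
  have hsum : ∀ s : ℝ, Real.log (a (s + n)) - Real.log (a s) =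
      ∑ j ∈ Finset.range n, Real.log (f.d1 (γ (s + j))) := by
    intro s
    have := Finset.sum_range_sub (fun j : ℕ => Real.log (a (s + j))) n
    simp only [Nat.cast_zero, add_zero] at this
    rw [← this]
    refine Finset.sum_congr rfl fun j _ => ?_
    rw [hγ.log_d1_eq hf]
    push_cast
    rw [add_assoc]
  rw [hsum, hsum, ← Finset.sum_sub_distrib]
  have hstep : ∀ j ∈ Finset.range n,
      |Real.log (f.d1 (γ (s₀ + r + j))) - Real.log (f.d1 (γ (s₀ + j)))| ≤
        C * (γ (s₀ + ↑(j + 1)) - γ (s₀ + j)) := by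
    intro j _
    have h1 := (convex_Ioo (0 : ℝ) 1).norm_image_sub_le_of_norm_hasDerivWithin_le
      (fun w hw => (f.hasDerivAt_log_d1 hw).hasDerivWithinAt)
      (fun w hw => hN w (Ioo_subset_Icc_self hw)) (hγ.mem (s₀ + j)) (hγ.mem (s₀ + r + j))
    refine h1.trans (mul_le_mul_of_nonneg_left ?_ hC)
    have h2 : γ (s₀ + j) ≤ γ (s₀ + r + j) := hγ.strictMono.monotone (by linarith [hr.1])
    have h3 : γ (s₀ + r + j) ≤ γ (s₀ + ↑(j + 1)) :=
      hγ.strictMono.monotone (by push_cast; linarith [hr.2])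
    rw [Real.norm_eq_abs, abs_of_nonneg (by linarith)]
    linarith
  refine (Finset.abs_sum_le_sum_abs _ _).trans ((Finset.sum_le_sum hstep).trans ?_)
  rw [← Finset.mul_sum, Finset.sum_range_sub (fun j : ℕ => γ (s₀ + j))]
  exact mul_le_of_le_one_right hC (by linarith [(hγ.mem (s₀ + n)).2, (hγ.mem (s₀ + (0 : ℕ))).1])

/-- Distortion compares the oscillation of log a on [k, k+1] with that on [0,1], which is bounded by
compactness. For negative k the comparison starts at k and ends at 0. -/
theorem exists_log_osc_bound (hγ : IsFlowCoordinate γ a b)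
    (hf : ∀ s, f.real (γ s) = γ (s + 1)) :
    ∃ C, ∀ (k : ℤ), ∀ r ∈ Icc (0 : ℝ) 1, |Real.log (a (k + r)) - Real.log (a k)| ≤ C := by
  obtain ⟨C, hC, hN⟩ := f.exists_nl_bound
  have hcont : Continuous fun r => Real.log (a r) - Real.log (a 0) :=
    (continuous_iff_continuousAt.2 fun s => (hγ.hasDerivAt_log s).continuousAt).sub continuous_const
  obtain ⟨M, hM⟩ := isCompact_Icc.exists_bound_of_continuousOn
    (s := Icc (0 : ℝ) 1) hcont.continuousOn
  refine ⟨C + M, fun k r hr => ?_⟩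
  have h1 := abs_le.1 (hM r hr)
  obtain ⟨n, rfl | rfl⟩ := k.eq_nat_or_neg
  · have h2 := abs_le.1 (hγ.abs_log_shift_sub_le hf hC hN 0 hr n)
    rw [zero_add, zero_add] at h2
    rw [Int.cast_natCast, add_comm (n : ℝ) r, abs_le]
    constructor <;> linarith
  · have h2 := abs_le.1 (hγ.abs_log_shift_sub_le hf hC hN (-n) hr n)
    rw [neg_add_cancel, show -(n : ℝ) + r + n = r by ring] at h2
    rw [Int.cast_neg, Int.cast_natCast, abs_le]
    constructor <;> linarith

/-- The logarithmic derivative of the generating vector field is bounded. -/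
theorem exists_bound (hγ : IsFlowCoordinate γ a b) (hf : ∀ s, f.real (γ s) = γ (s + 1)) :
    ∃ K, 0 ≤ K ∧ ∀ s, |b s| ≤ K := by
  obtain ⟨C, hC, hN⟩ := f.exists_nl_bound
  obtain ⟨O, hO⟩ := hγ.exists_log_osc_bound hf
  -- On [k, k+1] the value of a is at most a constant times the length of γ([k, k+1]). These lengths
  -- are summable, hence so are the increments |b(s+1) − b(s)| ≤ C a(s) along integer translates.
  have hup : ∀ (k : ℤ), ∀ r ∈ Icc (0 : ℝ) 1,
      a (k + r) ≤ Real.exp (2 * O) * (γ ((k + 1 : ℤ)) - γ k) := by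
    intro k r hr
    obtain ⟨c, hc, h⟩ := exists_hasDerivAt_eq_slope γ a (show (k : ℝ) < k + 1 by linarith)
      hγ.continuous.continuousOn (fun z _ => hγ.hasDerivAt z)
    rw [add_sub_cancel_left, div_one] at h
    push_cast
    rw [← h]
    have h1 := abs_le.1 (hO k r hr)
    have h2 := abs_le.1 (hO k (c - k) ⟨by linarith [hc.1], by linarith [hc.2]⟩)
    rw [add_sub_cancel] at h2
    have h3 : Real.log (a (k + r)) ≤ 2 * O + Real.log (a c) := by linarith
    have h4 := Real.exp_le_exp.2 h3
    rwa [Real.exp_add, Real.exp_log (hγ.pos _), Real.exp_log (hγ.pos _)] at h4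
  have hsum : ∀ (k : ℤ) (n : ℕ), ∀ r ∈ Icc (0 : ℝ) 1,
      |b (k + r + n) - b (k + r)| ≤ C * Real.exp (2 * O) := by
    intro k n r hr
    have h1 := Finset.sum_range_sub (fun j : ℕ => b (k + r + j)) n
    simp only [Nat.cast_zero, add_zero] at h1
    rw [← h1]
    have hstep : ∀ j ∈ Finset.range n, |b (k + r + ↑(j + 1)) - b (k + r + j)| ≤
        C * Real.exp (2 * O) * (γ (k + ↑(j + 1)) - γ (k + j)) := by
      intro j _
      have h2 := hγ.abs_shift_sub_le hf hN (k + r + j)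
      have h3 := hup (k + j) r hr
      push_cast at h3 ⊢
      rw [show (k : ℝ) + r + (j + 1) = k + r + j + 1 by ring]
      refine h2.trans ?_
      rw [mul_assoc, show (k : ℝ) + r + j = k + j + r by ring, ← add_assoc]
      exact mul_le_mul_of_nonneg_left h3 hC
    refine (Finset.abs_sum_le_sum_abs _ _).trans ((Finset.sum_le_sum hstep).trans ?_)
    rw [← Finset.mul_sum, Finset.sum_range_sub (fun j : ℕ => γ (k + j))]
    exact mul_le_of_le_one_right (by positivity)
      (by linarith [(hγ.mem (k + n)).2, (hγ.mem (k + (0 : ℕ))).1])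
  obtain ⟨M, hM⟩ := isCompact_Icc.exists_bound_of_continuousOn
    (s := Icc (0 : ℝ) 1) hγ.cont.continuousOn
  have hM0 : 0 ≤ M := (norm_nonneg _).trans (hM 0 (by simp))
  refine ⟨M + C * Real.exp (2 * O), by positivity, fun s => ?_⟩
  have hr : Int.fract s ∈ Icc (0 : ℝ) 1 := ⟨Int.fract_nonneg s, (Int.fract_lt_one s).le⟩
  have h1 := abs_le.1 (hM _ hr)
  have hs := Int.floor_add_fract s
  rw [abs_le]
  obtain ⟨n, hn | hn⟩ := ⌊s⌋.eq_nat_or_neg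
  · have h2 := abs_le.1 (hsum 0 n _ hr)
    rw [Int.cast_zero, zero_add] at h2
    rw [hn, Int.cast_natCast, add_comm] at hs
    rw [hs] at h2
    constructor <;> linarith
  · have h2 := abs_le.1 (hsum (-n) n _ hr)
    rw [hn] at hs
    rw [hs] at h2
    push_cast at hs
    rw [show s + n = Int.fract s by linarith] at h2
    constructor <;> linarith

theorem abs_log_sub_le (hγ : IsFlowCoordinate γ a b) {K : ℝ} (hK : ∀ s, |b s| ≤ K) (x y : ℝ) :
    |Real.log (a y) - Real.log (a x)| ≤ K * |y - x| :=
  abs_sub_le_of_hasDerivAt hγ.hasDerivAt_log fun s _ => hK s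

theorem le_exp_mul (hγ : IsFlowCoordinate γ a b) {K : ℝ} (hK0 : 0 ≤ K) (hK : ∀ s, |b s| ≤ K)
    {x y : ℝ} (hxy : |y - x| ≤ 1) : a y ≤ Real.exp K * a x := by
  have h1 := (abs_le.1 (hγ.abs_log_sub_le hK x y)).2
  have h2 : Real.log (a y) ≤ K + Real.log (a x) := by nlinarith
  have h3 := Real.exp_le_exp.2 h2
  rwa [Real.exp_add, Real.exp_log (hγ.pos _), Real.exp_log (hγ.pos _)] at h3

theorem shift_sub_le (hγ : IsFlowCoordinate γ a b) {K : ℝ} (hK0 : 0 ≤ K) (hK : ∀ s, |b s| ≤ K)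
    (s : ℝ) : a s ≤ Real.exp K * (γ (s + 1) - γ s) ∧ γ (s + 1) - γ s ≤ Real.exp K * a s := by
  obtain ⟨c, hc, h⟩ := exists_hasDerivAt_eq_slope γ a (show s < s + 1 by linarith)
    hγ.continuous.continuousOn (fun z _ => hγ.hasDerivAt z)
  rw [add_sub_cancel_left, div_one] at h
  rw [← h]
  exact ⟨hγ.le_exp_mul hK0 hK (abs_le.2 ⟨by linarith [hc.2], by linarith [hc.1]⟩),
    hγ.le_exp_mul hK0 hK (abs_le.2 ⟨by linarith [hc.1], by linarith [hc.2]⟩)⟩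

end IsFlowCoordinate

/-! ### The displacement of a parabolic diffeomorphism -/

namespace DiffTwo

/-- If `f ≥ id` is parabolic at both ends, the derivative of its displacement is bounded by the
square root of the displacement. -/
theorem sq_d1_sub_one_le {f : DiffTwo} (hle : ∀ x ∈ Icc (0 : ℝ) 1, x ≤ f.real x)
    (h0 : f.d1 0 = 1) (h1 : f.d1 1 = 1) {C : ℝ} (hC : 0 < C)
    (h2 : ∀ x ∈ Icc (0 : ℝ) 1, |f.d2 x| ≤ C) {x : ℝ} (hx : x ∈ Icc (0 : ℝ) 1) :
    (f.d1 x - 1) ^ 2 ≤ 2 * C * (f.real x - x) := by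
  have hlip : ∀ y ∈ Icc (0 : ℝ) 1, ∀ z ∈ Icc (0 : ℝ) 1, |f.d1 z - f.d1 y| ≤ C * |z - y| :=
    fun y hy z hz => (convex_Icc (0 : ℝ) 1).norm_image_sub_le_of_norm_hasDerivWithin_le
      (fun w hw => f.hasDerivWithinAt_d1 hw) h2 hy hz
  set p := f.d1 x - 1 with hp
  -- y minimises the Taylor majorant of the displacement, whose minimum is f x − x − p²/(2C);
  -- nonnegativity of the displacement at y concludes. Since Df = 1 at both ends and Df is
  -- C-Lipschitz, −C(1−x) ≤ p ≤ C x, so y stays in [0,1].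
  set y := x - p / C with hy
  have hyI : y ∈ Icc (0 : ℝ) 1 := by
    have e0 := (abs_le.1 (hlip 0 (by simp) x hx)).2
    have e1 := (abs_le.1 (hlip 1 (by simp) x hx)).1
    rw [h0, sub_zero, abs_of_nonneg hx.1] at e0
    rw [h1, abs_of_nonpos (by linarith [hx.2])] at e1
    have e2 : p / C ≤ x := by rw [div_le_iff₀ hC]; linarith
    have e3 : -(1 - x) ≤ p / C := by rw [le_div_iff₀ hC]; linarith
    exact ⟨by linarith, by linarith⟩
  -- Taylor's estimate between `x` and `y`
  have htaylor : f.real y - y ≤ f.real x - x + p * (y - x) + C * (y - x) ^ 2 / 2 := by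
    have hd : ∀ w ∈ Icc (0 : ℝ) 1, HasDerivWithinAt
        (fun z => f.real z - z - p * (z - x) - C * (z - x) ^ 2 / 2)
        (f.d1 w - 1 - p - C * (w - x)) (Icc 0 1) w := by
      intro w hw
      have e1 := (f.hasDerivWithinAt_real hw).sub (hasDerivWithinAt_id w _)
      have e2 := ((hasDerivWithinAt_id w (Icc 0 1)).sub_const x).const_mul p
      have e3 := ((((hasDerivWithinAt_id w (Icc 0 1)).sub_const x).pow 2).const_mul C).div_const 2
      refine ((e1.sub e2).sub e3).congr_deriv ?_
      simp only [id]
      ring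
    have hcont : ContinuousOn (fun z => f.real z - z - p * (z - x) - C * (z - x) ^ 2 / 2)
        (Icc 0 1) := fun w hw => (hd w hw).continuousWithinAt
    have hder : ∀ w ∈ Ioo (0 : ℝ) 1, HasDerivAt
        (fun z => f.real z - z - p * (z - x) - C * (z - x) ^ 2 / 2)
        (f.d1 w - 1 - p - C * (w - x)) w := fun w hw =>
      (hd w (Ioo_subset_Icc_self hw)).hasDerivAt (Icc_mem_nhds hw.1 hw.2)
    rcases le_total x y with hxy | hxy
    · have hanti : AntitoneOn (fun z => f.real z - z - p * (z - x) - C * (z - x) ^ 2 / 2)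
          (Icc x y) := by
        refine antitoneOn_of_deriv_nonpos (convex_Icc x y)
          (hcont.mono (Icc_subset_Icc hx.1 hyI.2)) ?_ ?_
        all_goals
          intro w hw
          rw [interior_Icc] at hw
          have hwI : w ∈ Ioo (0 : ℝ) 1 := ⟨hx.1.trans_lt hw.1, hw.2.trans_le hyI.2⟩
        · exact (hder w hwI).differentiableAt.differentiableWithinAt
        · rw [(hder w hwI).deriv]
          have := (abs_le.1 (hlip x hx w (Ioo_subset_Icc_self hwI))).2
          rw [abs_of_nonneg (by linarith [hw.1])] at this
          linarith
      have := hanti (left_mem_Icc.2 hxy) (right_mem_Icc.2 hxy) hxy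
      simp only [sub_self] at this
      linarith
    · have hmono : MonotoneOn (fun z => f.real z - z - p * (z - x) - C * (z - x) ^ 2 / 2)
          (Icc y x) := by
        refine monotoneOn_of_deriv_nonneg (convex_Icc y x)
          (hcont.mono (Icc_subset_Icc hyI.1 hx.2)) ?_ ?_
        all_goals
          intro w hw
          rw [interior_Icc] at hw
          have hwI : w ∈ Ioo (0 : ℝ) 1 := ⟨hyI.1.trans_lt hw.1, hw.2.trans_le hx.2⟩
        · exact (hder w hwI).differentiableAt.differentiableWithinAt
        · rw [(hder w hwI).deriv]
          have := (abs_le.1 (hlip x hx w (Ioo_subset_Icc_self hwI))).1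
          rw [abs_of_nonpos (by linarith [hw.2])] at this
          linarith
      have := hmono (left_mem_Icc.2 hxy) (right_mem_Icc.2 hxy) hxy
      simp only [sub_self] at this
      linarith
  have h3 := hle y hyI
  have h4 : p * (y - x) + C * (y - x) ^ 2 / 2 = -(p ^ 2 / (2 * C)) := by
    rw [hy]
    field_simp
    ring
  have h5 : p ^ 2 / (2 * C) ≤ f.real x - x := by linarith
  rw [div_le_iff₀ (by positivity)] at h5
  linarith

end DiffTwo

/-- This is `sq_d1_sub_one_le` read in the coordinate: the increment of log a is log Df, comparable
to Df − 1, and the displacement γ(s+1) − γ(s) is at most a constant times a(s). -/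
theorem IsFlowCoordinate.exists_sq_log_shift_le {γ a b : ℝ → ℝ} (hγ : IsFlowCoordinate γ a b)
    {f : DiffTwo} (hf : ∀ s, f.real (γ s) = γ (s + 1)) (h0 : f.d1 0 = 1) (h1 : f.d1 1 = 1)
    {K : ℝ} (hK0 : 0 ≤ K) (hK : ∀ s, |b s| ≤ K) :
    ∃ C, 0 ≤ C ∧ ∀ s, (Real.log (a (s + 1)) - Real.log (a s)) ^ 2 ≤ C * a s := by
  obtain ⟨C, hC⟩ := isCompact_Icc.exists_bound_of_continuousOn f.continuousOn_d2
  have hC0 : 0 ≤ C := (norm_nonneg _).trans (hC 0 (by simp))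
  obtain ⟨x₀, hx₀, hmin⟩ := isCompact_Icc.exists_isMinOn (nonempty_Icc.2 zero_le_one)
    f.continuousOn_d1
  set m := min 1 (f.d1 x₀) with hm
  have hm0 : 0 < m := lt_min one_pos (f.d1_pos hx₀)
  have hle : ∀ x ∈ Icc (0 : ℝ) 1, x ≤ f.real x := by
    intro x hx
    rcases hx.1.eq_or_lt with h | h
    · rw [← h, f.real_zero]
    rcases hx.2.eq_or_lt with h' | h'
    · rw [h', f.real_at_one]
    obtain ⟨s, rfl⟩ := hγ.surj x ⟨h, h'⟩
    rw [hf]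
    exact (hγ.strictMono (by linarith)).le
  refine ⟨2 * (C + 1) * Real.exp K / m ^ 2, by positivity, fun s => ?_⟩
  rw [← hγ.log_d1_eq hf]
  have hs := hγ.mem_Icc s
  have hpos := f.d1_pos hs
  have h2 := DiffTwo.sq_d1_sub_one_le hle h0 h1 (C := C + 1) (by linarith)
    (fun x hx => (hC x hx).trans (by linarith)) hs
  rw [hf] at h2
  have h3 := (hγ.shift_sub_le hK0 hK s).2
  have hmd : m ≤ f.d1 (γ s) := (min_le_right _ _).trans (hmin hs)
  have hm1 : m ≤ 1 := min_le_left _ _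
  have h4 : |Real.log (f.d1 (γ s))| ≤ |f.d1 (γ s) - 1| / m := by
    rw [le_div_iff₀ hm0]
    have e1 := Real.log_le_sub_one_of_pos hpos
    have e2 := Real.one_sub_inv_le_log_of_pos hpos
    rcases le_total 1 (f.d1 (γ s)) with h | h
    · rw [abs_of_nonneg (Real.log_nonneg h), abs_of_nonneg (by linarith)]
      nlinarith [Real.log_nonneg h]
    · rw [abs_of_nonpos (Real.log_nonpos hpos.le h), abs_of_nonpos (by linarith)]
      have e3 : -Real.log (f.d1 (γ s)) * f.d1 (γ s) ≤ -(f.d1 (γ s) - 1) := by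
        have := mul_le_mul_of_nonneg_right e2 hpos.le
        rw [sub_mul, inv_mul_cancel₀ hpos.ne'] at this
        linarith
      nlinarith [Real.log_nonpos hpos.le h]
  calc Real.log (f.d1 (γ s)) ^ 2 ≤ (|f.d1 (γ s) - 1| / m) ^ 2 :=
        sq_le_sq' (by linarith [(abs_le.1 h4).1]) (abs_le.1 h4).2
    _ = (f.d1 (γ s) - 1) ^ 2 / m ^ 2 := by rw [div_pow, sq_abs]
    _ ≤ 2 * (C + 1) * (Real.exp K * a s) / m ^ 2 := by
        gcongr
        exact h2.trans (by gcongr)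
    _ = _ := by ring

/-! ### A compactly supported bump with bounded second difference -/

/-- The bump `(S² - s²)₊² / S²`. -/
def bump (S s : ℝ) : ℝ := (max 0 (S ^ 2 - s ^ 2)) ^ 2 / S ^ 2

/-- The derivative of `bump S`. -/
def bumpDeriv (S s : ℝ) : ℝ := -(4 * s * max 0 (S ^ 2 - s ^ 2)) / S ^ 2

theorem hasDerivAt_max_zero_sq (u : ℝ) :
    HasDerivAt (fun u : ℝ => (max 0 u) ^ 2) (2 * max 0 u) u := by
  rcases lt_trichotomy u 0 with h | rfl | h
  · rw [max_eq_left h.le, mul_zero]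
    refine (hasDerivAt_const u (0 : ℝ)).congr_of_eventuallyEq ?_
    filter_upwards [Iio_mem_nhds h] with v hv
    rw [max_eq_left (le_of_lt hv)]
    norm_num
  · rw [max_self, mul_zero, hasDerivAt_iff_isLittleO_nhds_zero]
    simp only [zero_add, max_self, smul_zero, sub_zero]
    rw [zero_pow two_ne_zero]
    simp only [sub_zero]
    refine Asymptotics.IsBigO.trans_isLittleO (g := fun h : ℝ => h ^ 2) ?_
      (Asymptotics.isLittleO_pow_id one_lt_two)
    refine Asymptotics.IsBigO.of_bound 1 (Eventually.of_forall fun v => ?_)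
    rw [one_mul, norm_pow, norm_pow]
    refine pow_le_pow_left₀ (norm_nonneg _) ?_ 2
    rw [Real.norm_eq_abs, Real.norm_eq_abs, abs_of_nonneg (le_max_left 0 v)]
    exact max_le (abs_nonneg v) (le_abs_self v)
  · rw [max_eq_right h.le]
    have := hasDerivAt_pow 2 u
    norm_num at this
    refine this.congr_of_eventuallyEq ?_
    filter_upwards [Ioi_mem_nhds h] with v hv
    rw [max_eq_right (le_of_lt hv)]

theorem hasDerivAt_bump (S s : ℝ) : HasDerivAt (bump S) (bumpDeriv S s) s := by
  have h1 : HasDerivAt (fun s : ℝ => S ^ 2 - s ^ 2) (-(2 * s)) s := by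
    simpa using (hasDerivAt_pow 2 s).const_sub (S ^ 2)
  have h2 := ((hasDerivAt_max_zero_sq (S ^ 2 - s ^ 2)).comp s h1).div_const (S ^ 2)
  refine h2.congr_deriv ?_
  rw [bumpDeriv]
  ring

theorem continuous_bumpDeriv (S : ℝ) : Continuous (bumpDeriv S) := by
  unfold bumpDeriv
  fun_prop

theorem bump_nonneg (S s : ℝ) : 0 ≤ bump S s := by
  unfold bump
  positivity

theorem bump_eq_zero {S s : ℝ} (hS : 0 < S) (h : S ≤ |s|) : bump S s = 0 := by
  have : S ^ 2 - s ^ 2 ≤ 0 := by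
    rw [← sq_abs s]
    nlinarith
  rw [bump, max_eq_left this]
  simp

theorem le_bump {S s : ℝ} (hS : 0 < S) (h : |s| ≤ S / 2) : S ^ 2 / 2 ≤ bump S s := by
  have h1 : 3 / 4 * S ^ 2 ≤ S ^ 2 - s ^ 2 := by
    rw [← sq_abs s]
    nlinarith [abs_nonneg s]
  have h0 : 0 < S ^ 2 := by positivity
  rw [bump, max_eq_right (by linarith), le_div_iff₀ (by positivity)]
  nlinarith

/-- The bump is S² times a fixed profile of s/S, so this constant and the Lipschitz constant in
`abs_bumpDeriv_sub_le` do not depend on S. -/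
theorem sq_bumpDeriv_le {S : ℝ} (hS : 0 < S) (s : ℝ) :
    bumpDeriv S s ^ 2 ≤ 16 * bump S s := by
  rcases le_total S |s| with h | h
  · have : S ^ 2 - s ^ 2 ≤ 0 := by
      rw [← sq_abs s]
      nlinarith
    rw [bumpDeriv, max_eq_left this, bump_eq_zero hS h]
    simp
  · have h1 : s ^ 2 ≤ S ^ 2 := by
      rw [← sq_abs s]
      nlinarith [abs_nonneg s]
    have h2 : bumpDeriv S s ^ 2 = 16 * bump S s * (s ^ 2 / S ^ 2) := by
      rw [bumpDeriv, bump]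
      field_simp
      ring
    rw [h2]
    exact mul_le_of_le_one_right (by linarith [bump_nonneg S s])
      (div_le_one_of_le₀ h1 (by positivity))

theorem abs_bumpDeriv_sub_le {S : ℝ} (hS : 0 < S) (s t : ℝ) :
    |bumpDeriv S t - bumpDeriv S s| ≤ 8 * |t - s| := by
  -- the one-sided estimate, for a point outside of the support
  have hout : ∀ u w : ℝ, |u| ≤ S → S ≤ |w| → |u * (S ^ 2 - u ^ 2)| ≤ 2 * S ^ 2 * |w - u| := by
    intro u w hu hw
    have h1 : |w - u| ≥ S - |u| := by
      have := abs_sub_abs_le_abs_sub w u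
      linarith
    have h2 : S ^ 2 - u ^ 2 = (S - |u|) * (S + |u|) := by
      rw [← sq_abs u]
      ring
    rw [h2, abs_mul, abs_of_nonneg
      (mul_nonneg (sub_nonneg.2 hu) (add_nonneg hS.le (abs_nonneg u)))]
    calc |u| * ((S - |u|) * (S + |u|)) ≤ S * ((S - |u|) * (S + S)) := by
          have : 0 ≤ S - |u| := by linarith
          gcongr
      _ = 2 * S ^ 2 * (S - |u|) := by ring
      _ ≤ _ := by gcongr
  have hmain : |t * max 0 (S ^ 2 - t ^ 2) - s * max 0 (S ^ 2 - s ^ 2)| ≤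
      2 * S ^ 2 * |t - s| := by
    have hin : ∀ u : ℝ, |u| ≤ S → max 0 (S ^ 2 - u ^ 2) = S ^ 2 - u ^ 2 := fun u hu => by
      refine max_eq_right ?_
      rw [← sq_abs u]
      nlinarith [abs_nonneg u]
    have hou : ∀ u : ℝ, S ≤ |u| → max 0 (S ^ 2 - u ^ 2) = 0 := fun u hu => by
      refine max_eq_left ?_
      rw [← sq_abs u]
      nlinarith [abs_nonneg u]
    rcases le_total S |s| with h | h <;> rcases le_total S |t| with h' | h'
    · rw [hou s h, hou t h']
      simp only [mul_zero, sub_zero, abs_zero]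
      positivity
    · rw [hou s h, hin t h', mul_zero, sub_zero, abs_sub_comm t s]
      exact hout t s h' h
    · rw [hin s h, hou t h', mul_zero, zero_sub, abs_neg]
      exact hout s t h h'
    · rw [hin s h, hin t h', show t * (S ^ 2 - t ^ 2) - s * (S ^ 2 - s ^ 2) =
        (S ^ 2 - (t ^ 2 + t * s + s ^ 2)) * (t - s) by ring, abs_mul]
      refine mul_le_mul_of_nonneg_right ?_ (abs_nonneg _)
      have a1 := abs_le.1 h
      have a2 := abs_le.1 h'
      exact abs_le.2 ⟨by nlinarith, by nlinarith [sq_nonneg (t + s), sq_nonneg t, sq_nonneg s]⟩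
  have heq : bumpDeriv S t - bumpDeriv S s =
      -(4 / S ^ 2) * (t * max 0 (S ^ 2 - t ^ 2) - s * max 0 (S ^ 2 - s ^ 2)) := by
    rw [bumpDeriv, bumpDeriv]
    ring
  rw [heq, abs_mul, abs_neg, abs_of_pos (by positivity)]
  calc _ ≤ 4 / S ^ 2 * (2 * S ^ 2 * |t - s|) := by gcongr
    _ = _ := by field_simp; ring

theorem abs_bump_sub_le {S : ℝ} (hS : 0 < S) (s : ℝ) :
    |bump S (s + 1) - bump S s| ≤ |bumpDeriv S s| + 8 := by
  have := abs_sub_le_of_hasDerivAt (K := |bumpDeriv S s| + 8) (hasDerivAt_bump S) (x := s)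
    (y := s + 1) fun t ht => by
      rw [uIcc_of_le (by linarith)] at ht
      have h1 := abs_bumpDeriv_sub_le hS s t
      have h2 : |t - s| ≤ 1 := abs_le.2 ⟨by linarith [ht.1], by linarith [ht.2]⟩
      have h3 := abs_sub_abs_le_abs_sub (bumpDeriv S t) (bumpDeriv S s)
      linarith
  simpa using this

/-! ### The second difference of the flattened vector field -/

/-- Let `P' = -b P` with `P` of bounded variation rate, and let `R = P + bump S`. If
`b² ≤ k² / P` on the support of the bump, then `(log R)'` has a first difference at most a constant
times `1 / R`, where the constant is independent of `S`. -/
theorem exists_second_difference_bound {M d A k : ℝ} (hM : 1 ≤ M) (hd : 0 ≤ d) (hA : 0 ≤ A)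
    (hk : 0 ≤ k) : ∃ C, 0 ≤ C ∧ ∀ (S : ℝ) (P b : ℝ → ℝ), 0 < S → (∀ s, 0 < P s) →
      (∀ s, HasDerivAt P (-(b s * P s)) s) →
      (∀ s, ∀ r ∈ Icc (0 : ℝ) 1, P (s + r) ≤ M ^ 2 * P s) →
      (∀ s, P s ≤ M ^ 2 * P (s + 1)) → (∀ s, 1 ≤ d ^ 2 * P s) →
      (∀ s, |b (s + 1) - b s| * P s ≤ A) →
      (∀ s ∈ Icc (-S - 1) (S + 1), b s ^ 2 * P s ≤ k ^ 2) →
      ∀ s, |(b (s + 1) * P (s + 1) - bumpDeriv S (s + 1)) / (P (s + 1) + bump S (s + 1)) -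
        (b s * P s - bumpDeriv S s) / (P s + bump S s)| * (P s + bump S s) ≤ C := by
  -- The first factor bounds R(s)/R(s+1), see `hR`; the second adds the bounds `T1`, `T2`, `hφ2` and
  -- `T4` of the four terms of `hB`.
  refine ⟨(M ^ 2 + 2 + 12 * d ^ 2) *
    (A * M ^ 2 + k * (k * M + 2 + 8 * d) + 8 + (2 * (k * M) + 16 + 16 * d)), by positivity, ?_⟩
  intro S P b hS hP hderiv hup hdown hdP hbA hbk s
  -- In terms of p = √P and q = √φ the estimates become quadratic forms, to be compared with R = p²
  -- + q²: |φ'| ≤ 4q, |b| p ≤ k near the support, and lower order terms are absorbed by 1 ≤ d p.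
  set p := √(P s) with hp
  set q := √(bump S s) with hq
  have hp2 : p ^ 2 = P s := Real.sq_sqrt (hP s).le
  have hq2 : q ^ 2 = bump S s := Real.sq_sqrt (bump_nonneg S s)
  have hp0 : 0 < p := Real.sqrt_pos.2 (hP s)
  have hq0 : 0 ≤ q := Real.sqrt_nonneg _
  have hdp : 1 ≤ d * p := by
    have : 1 ≤ (d * p) ^ 2 := by rw [mul_pow, hp2]; exact hdP s
    exact (one_le_sq_iff₀ (by positivity)).1 this
  have hφ' : |bumpDeriv S s| ≤ 4 * q := by
    refine abs_le_of_sq_le_sq ?_ (by positivity)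
    have := sq_bumpDeriv_le hS s
    rw [← hq2] at this
    linarith
  have hφ1 : |bump S (s + 1) - bump S s| ≤ 4 * q + 8 := by
    linarith [abs_bump_sub_le hS s]
  have hφ2 : |bumpDeriv S (s + 1) - bumpDeriv S s| ≤ 8 := by
    have := abs_bumpDeriv_sub_le hS s (s + 1)
    rwa [add_sub_cancel_left, abs_one, mul_one] at this
  have hR0 : 0 < P s + bump S s := add_pos_of_pos_of_nonneg (hP s) (bump_nonneg S s)
  have hR1 : 0 < P (s + 1) + bump S (s + 1) :=
    add_pos_of_pos_of_nonneg (hP _) (bump_nonneg S _)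
  set P0 := P s
  set P1 := P (s + 1)
  set φ0 := bump S s
  set φ1 := bump S (s + 1)
  set ψ0 := bumpDeriv S s
  set ψ1 := bumpDeriv S (s + 1)
  set b0 := b s
  set b1 := b (s + 1)
  have hP1M : P1 ≤ M ^ 2 * P0 := hup s 1 (by simp)
  -- estimates near the support of the bump
  have hnear : (bump S s ≠ 0 ∨ bump S (s + 1) ≠ 0) → |b0| * p ≤ k ∧ |P1 - P0| ≤ k * M * p := by
    intro h
    have hs : -S - 1 ≤ s ∧ s ≤ S := by
      rcases h with h | h
      · have : |s| < S := not_le.1 fun h' => h (bump_eq_zero hS h')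
        have := abs_lt.1 this
        constructor <;> linarith
      · have : |s + 1| < S := not_le.1 fun h' => h (bump_eq_zero hS h')
        have := abs_lt.1 this
        constructor <;> linarith
    constructor
    · refine abs_le_of_sq_le_sq' (a := |b0| * p) ?_ hk |>.2
      rw [mul_pow, sq_abs, hp2]
      exact hbk s ⟨hs.1, by linarith⟩
    · have := abs_sub_le_of_hasDerivAt (K := k * M * p) hderiv (x := s) (y := s + 1) fun t ht => by
        rw [uIcc_of_le (by linarith)] at ht
        have h1 := hbk t ⟨by linarith [ht.1], by linarith [ht.2]⟩
        have h2 := hup s (t - s) ⟨by linarith [ht.1], by linarith [ht.2]⟩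
        rw [add_sub_cancel] at h2
        refine abs_le_of_sq_le_sq ?_ (by positivity)
        calc (-(b t * P t)) ^ 2 = b t ^ 2 * P t * P t := by ring
          _ ≤ k ^ 2 * (M ^ 2 * P0) := mul_le_mul h1 h2 (hP t).le (by positivity)
          _ = (k * M * p) ^ 2 := by rw [mul_pow, mul_pow, hp2]; ring
      simpa using this
  have T1 : |(b1 - b0) * P1| ≤ A * M ^ 2 := by
    rw [abs_mul, abs_of_pos (hP _)]
    calc |b1 - b0| * P1 ≤ |b1 - b0| * (M ^ 2 * P0) := by gcongr
      _ = |b1 - b0| * P0 * M ^ 2 := by ring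
      _ ≤ _ := by gcongr; exact hbA s
  have hpq : 0 < p ^ 2 + q ^ 2 := by positivity
  have T2 : |b0 * (P1 * φ0 - P0 * φ1)| ≤ k * (k * M + 2 + 8 * d) * (p ^ 2 + q ^ 2) := by
    by_cases h : φ0 = 0 ∧ φ1 = 0
    · rw [h.1, h.2]
      simp only [mul_zero, sub_zero, abs_zero]
      positivity
    · obtain ⟨h1, h2⟩ := hnear (not_and_or.1 h)
      have h3 : |P1 * φ0 - P0 * φ1| ≤ k * M * p * q ^ 2 + p ^ 2 * (4 * q + 8) := by
        rw [show P1 * φ0 - P0 * φ1 = (P1 - P0) * φ0 - P0 * (φ1 - φ0) by ring, ← hp2, ← hq2]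
        refine (abs_sub _ _).trans ?_
        rw [abs_mul, abs_mul, abs_of_nonneg (sq_nonneg p), abs_of_nonneg (sq_nonneg q), hp2, hq2]
        have := bump_nonneg S s
        have := (hP s).le
        gcongr
      rw [abs_mul]
      calc |b0| * |P1 * φ0 - P0 * φ1| ≤ |b0| * (k * M * p * q ^ 2 + p ^ 2 * (4 * q + 8)) := by
            gcongr
        _ = |b0| * p * (k * M * q ^ 2 + p * (4 * q + 8)) := by ring
        _ ≤ k * (k * M * q ^ 2 + p * (4 * q + 8)) := by gcongr
        _ ≤ k * ((k * M + 2 + 8 * d) * (p ^ 2 + q ^ 2)) := by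
            gcongr
            have e1 : p ≤ d * p ^ 2 := by nlinarith
            have e2 : 0 ≤ k * M * p ^ 2 := by positivity
            have e3 : 0 ≤ d * q ^ 2 := by positivity
            nlinarith [sq_nonneg (p - q)]
        _ = _ := by ring
  have T4 : |ψ0 * ((P1 + φ1) - (P0 + φ0))| ≤ (2 * (k * M) + 16 + 16 * d) * (p ^ 2 + q ^ 2) := by
    by_cases h : φ0 = 0
    · have h1 : ψ0 = 0 := by
        have h2 : q = 0 := by rw [hq]; exact Real.sqrt_eq_zero'.2 h.le
        rw [h2, mul_zero] at hφ'
        exact abs_nonpos_iff.1 hφ'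
      rw [h1, zero_mul, abs_zero]
      positivity
    · obtain ⟨h1, h2⟩ := hnear (Or.inl h)
      have h3 : |(P1 + φ1) - (P0 + φ0)| ≤ k * M * p + (4 * q + 8) := by
        rw [show (P1 + φ1) - (P0 + φ0) = (P1 - P0) + (φ1 - φ0) by ring]
        exact (abs_add_le _ _).trans (add_le_add h2 hφ1)
      rw [abs_mul]
      calc |ψ0| * |(P1 + φ1) - (P0 + φ0)| ≤ 4 * q * (k * M * p + (4 * q + 8)) := by gcongr
        _ ≤ _ := by
            have e1 : q ≤ d * p * q := by nlinarith
            have e2 : 0 ≤ d * (p - q) ^ 2 := by positivity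
            have e3 : 0 ≤ k * M * (p - q) ^ 2 := by positivity
            nlinarith [sq_nonneg p]
  have hR : P0 + φ0 ≤ (M ^ 2 + 2 + 12 * d ^ 2) * (P1 + φ1) := by
    have h1 := hdown s
    have h2 := hdP (s + 1)
    have h3 := bump_nonneg S (s + 1)
    have h4 : φ0 ≤ 2 * φ1 + 12 := by
      -- From φ'² ≤ 16 φ ≤ (φ + 4)². The additive 12 = 4 + 8 that results is absorbed by 1 ≤ d² P.
      have e1 : |bumpDeriv S (s + 1)| ≤ φ1 + 4 := by
        refine abs_le_of_sq_le_sq ?_ (by positivity)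
        nlinarith [sq_bumpDeriv_le hS (s + 1), sq_nonneg (φ1 - 4)]
      have e2 := abs_sub_le_of_hasDerivAt (K := |bumpDeriv S (s + 1)| + 8) (hasDerivAt_bump S)
        (x := s + 1) (y := s) fun t ht => by
          rw [uIcc_of_ge (by linarith)] at ht
          have h1 := abs_bumpDeriv_sub_le hS (s + 1) t
          have h2 : |t - (s + 1)| ≤ 1 := abs_le.2 ⟨by linarith [ht.1], by linarith [ht.2]⟩
          have h3 := abs_sub_abs_le_abs_sub (bumpDeriv S t) (bumpDeriv S (s + 1))
          linarith
      rw [show s - (s + 1) = -1 by ring, abs_neg, abs_one, mul_one] at e2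
      have e3 := (abs_le.1 e2).2
      change φ0 - φ1 ≤ _ at e3
      linarith
    have e4 : 0 ≤ M ^ 2 * φ1 := by positivity
    have e5 : 0 ≤ d ^ 2 * φ1 := by positivity
    have e6 : 0 ≤ P1 := (hP _).le
    change P0 ≤ M ^ 2 * P1 at h1
    change 1 ≤ d ^ 2 * P1 at h2
    nlinarith
  -- Splitting the difference of quotients so that each summand contains a single type of first
  -- difference.
  have hB : ((b1 * P1 - ψ1) / (P1 + φ1) - (b0 * P0 - ψ0) / (P0 + φ0)) * (P1 + φ1) =
      (b1 - b0) * P1 + b0 * (P1 * φ0 - P0 * φ1) / (P0 + φ0) - (ψ1 - ψ0) +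
        ψ0 * ((P1 + φ1) - (P0 + φ0)) / (P0 + φ0) := by
    field_simp
    ring
  have hmain : |(b1 * P1 - ψ1) / (P1 + φ1) - (b0 * P0 - ψ0) / (P0 + φ0)| * (P1 + φ1) ≤
      A * M ^ 2 + k * (k * M + 2 + 8 * d) + 8 + (2 * (k * M) + 16 + 16 * d) := by
    rw [← abs_of_pos hR1, ← abs_mul, abs_of_pos hR1, hB]
    rw [hp2, hq2] at T2 T4
    have T2' : |b0 * (P1 * φ0 - P0 * φ1) / (P0 + φ0)| ≤ k * (k * M + 2 + 8 * d) := by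
      rw [abs_div, abs_of_pos hR0, div_le_iff₀ hR0]
      exact T2
    have T4' : |ψ0 * ((P1 + φ1) - (P0 + φ0)) / (P0 + φ0)| ≤ 2 * (k * M) + 16 + 16 * d := by
      rw [abs_div, abs_of_pos hR0, div_le_iff₀ hR0]
      exact T4
    refine (abs_add_le _ _).trans (add_le_add ((abs_sub _ _).trans (add_le_add
      ((abs_add_le _ _).trans (add_le_add T1 T2')) hφ2)) T4')
  calc _ ≤ |(b1 * P1 - ψ1) / (P1 + φ1) - (b0 * P0 - ψ0) / (P0 + φ0)| *
        ((M ^ 2 + 2 + 12 * d ^ 2) * (P1 + φ1)) := by gcongr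
    _ = (M ^ 2 + 2 + 12 * d ^ 2) *
        (|(b1 * P1 - ψ1) / (P1 + φ1) - (b0 * P0 - ψ0) / (P0 + φ0)| * (P1 + φ1)) := by ring
    _ ≤ _ := by gcongr

/-! ### Diffeomorphisms with prescribed derivative -/

theorem exists_openPartialHomeomorph {u u' : ℝ → ℝ} (hu : ∀ x, HasDerivAt u (u' x) x)
    (hc : Continuous u') (hpos : ∀ x, 0 < u' x) :
    ∃ e : OpenPartialHomeomorph ℝ ℝ, (∀ x, e x = u x) ∧ e.source = univ ∧ e.target = range u ∧
      ∀ x, ContDiffAt ℝ 1 e.symm (u x) := by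
  have hu1 : ContDiff ℝ 1 u := by
    refine contDiff_one_iff_deriv.2 ⟨fun x => (hu x).differentiableAt, ?_⟩
    rwa [show deriv u = u' from funext fun x => (hu x).deriv]
  have hstrict : ∀ x, HasStrictDerivAt u (u' x) x := fun x =>
    hu1.contDiffAt.hasStrictDerivAt' (hu x) one_ne_zero
  have hmono : StrictMono u := strictMono_of_deriv_pos fun x => by
    rw [(hu x).deriv]
    exact hpos x
  have hopen : IsOpenMap u := isOpenMap_of_hasStrictDerivAt hstrict fun x => (hpos x).ne'
  have hemb : Topology.IsOpenEmbedding u :=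
    .of_continuous_injective_isOpenMap hu1.continuous hmono.injective hopen
  refine ⟨hemb.toOpenPartialHomeomorph u, fun x => rfl, rfl, by simp, fun x => ?_⟩
  have hx : u x ∈ (hemb.toOpenPartialHomeomorph u).target := by simp
  have hsx : (hemb.toOpenPartialHomeomorph u).symm (u x) = x :=
    (hemb.toOpenPartialHomeomorph u).left_inv (mem_univ x)
  refine (hemb.toOpenPartialHomeomorph u).contDiffAt_symm_deriv (hpos x).ne' hx ?_ ?_
  · rw [hsx]
    exact hu x
  · exact hu1.contDiffAt

theorem contDiffOn_two_of_hasDerivWithinAt {u u' : ℝ → ℝ}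
    (hu : ∀ x ∈ Icc (0 : ℝ) 1, HasDerivWithinAt u (u' x) (Icc 0 1) x)
    (hu' : ContDiffOn ℝ 1 u' (Icc 0 1)) : ContDiffOn ℝ 2 u (Icc 0 1) := by
  rw [show (2 : WithTop ℕ∞) = 1 + 1 by norm_num,
    contDiffOn_succ_iff_derivWithin uniqueDiffOn_Icc_zero_one]
  refine ⟨fun x hx => (hu x hx).differentiableWithinAt, by simp, hu'.congr fun x hx => ?_⟩
  exact (hu x hx).derivWithin (uniqueDiffOn_Icc_zero_one x hx)

namespace DiffTwo

/-- h is the primitive of ρ divided by its total mass I. Extending ρ by constants to ℝ allows the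
inverse function theorem to be applied at the endpoints too. -/
theorem exists_of_d1 {ρ : ℝ → ℝ} (hρ : ContDiffOn ℝ 1 ρ (Icc 0 1))
    (hpos : ∀ x ∈ Icc (0 : ℝ) 1, 0 < ρ x) :
    ∃ (h : DiffTwo) (I : ℝ), 0 < I ∧ ∀ x ∈ Icc (0 : ℝ) 1, h.d1 x = ρ x / I := by
  let ρ' : ℝ → ℝ := IccExtend zero_le_one fun x : Icc (0 : ℝ) 1 => ρ x
  have hρ'c : Continuous ρ' := hρ.continuousOn.domRestrict.Icc_extend'
  have hρ'pos : ∀ x, 0 < ρ' x := fun x => hpos _ (projIcc 0 1 zero_le_one x).2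
  have hρ'eq : ∀ x ∈ Icc (0 : ℝ) 1, ρ' x = ρ x := fun x hx => IccExtend_of_mem _ _ hx
  let u : ℝ → ℝ := fun x => ∫ y in (0 : ℝ)..x, ρ' y
  have hu : ∀ x, HasDerivAt u (ρ' x) x := fun x => hρ'c.integral_hasStrictDerivAt 0 x |>.hasDerivAt
  have hu0 : u 0 = 0 := intervalIntegral.integral_same
  have humono : StrictMono u := strictMono_of_deriv_pos fun x => by
    rw [(hu x).deriv]
    exact hρ'pos x
  set I := u 1 with hI
  have hI0 : 0 < I := by
    have := humono zero_lt_one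
    rwa [hu0] at this
  let w : ℝ → ℝ := fun x => u x / I
  have hw : ∀ x, HasDerivAt w (ρ' x / I) x := fun x => (hu x).div_const I
  have hw0 : w 0 = 0 := by simp only [w, hu0, zero_div]
  have hw1 : w 1 = 1 := div_self hI0.ne'
  have hwmono : StrictMono w := fun x y hxy => div_lt_div_of_pos_right (humono hxy) hI0
  have hwmem : ∀ x ∈ Icc (0 : ℝ) 1, w x ∈ Icc (0 : ℝ) 1 := fun x hx =>
    ⟨hw0 ▸ hwmono.monotone hx.1, hw1 ▸ hwmono.monotone hx.2⟩
  have hwsurj : ∀ y ∈ Icc (0 : ℝ) 1, ∃ x ∈ Icc (0 : ℝ) 1, w x = y := by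
    have := intermediate_value_Icc zero_le_one
      (fun x _ => (hw x).continuousAt.continuousWithinAt : ContinuousOn w (Icc 0 1))
    rw [hw0, hw1] at this
    exact this
  let e : unitInterval ≃o unitInterval := StrictMono.orderIsoOfSurjective
    (fun x : unitInterval => (⟨w x, hwmem x x.2⟩ : unitInterval))
    (fun x y hxy => hwmono hxy) (fun y => by
      obtain ⟨x, hx, h⟩ := hwsurj y y.2
      exact ⟨⟨x, hx⟩, Subtype.ext h⟩)
  have hereal : ∀ x ∈ Icc (0 : ℝ) 1, IntervalDiff.real e x = w x := fun x hx =>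
    IntervalDiff.real_apply e ⟨x, hx⟩
  have hder : ∀ x ∈ Icc (0 : ℝ) 1,
      HasDerivWithinAt (IntervalDiff.real e) (ρ x / I) (Icc 0 1) x := fun x hx => by
    rw [← hρ'eq x hx]
    exact (hw x).hasDerivWithinAt.congr hereal (hereal x hx)
  have hC2 : IntervalDiff.IsC2 e :=
    contDiffOn_two_of_hasDerivWithinAt hder (hρ.div_const I)
  obtain ⟨E, hE, hEs, hEt, hEc⟩ := exists_openPartialHomeomorph hw (hρ'c.div_const I)
    fun x => div_pos (hρ'pos x) hI0
  have hEsymm : ∀ x, E.symm (w x) = x := fun x => by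
    rw [← hE]
    exact E.left_inv (hEs ▸ mem_univ x)
  have hsreal : ∀ y ∈ Icc (0 : ℝ) 1, IntervalDiff.real e.symm y = E.symm y := by
    intro y hy
    obtain ⟨x, hx, rfl⟩ := hwsurj y hy
    rw [hEsymm]
    refine (IntervalDiff.real_apply e.symm ⟨w x, hy⟩).trans ?_
    have : e.symm ⟨w x, hy⟩ = ⟨x, hx⟩ := e.symm_apply_eq.2 rfl
    rw [this]
  have hEmaps : MapsTo E.symm (Icc 0 1) (Icc 0 1) := by
    intro y hy
    obtain ⟨x, hx, rfl⟩ := hwsurj y hy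
    rwa [hEsymm]
  have hEcont : ContDiffOn ℝ 1 E.symm (Icc 0 1) := by
    intro y hy
    obtain ⟨x, hx, rfl⟩ := hwsurj y hy
    exact (hEc x).contDiffWithinAt
  have hC2' : IntervalDiff.IsC2 e.symm := by
    refine contDiffOn_two_of_hasDerivWithinAt (u' := fun y => (ρ (E.symm y) / I)⁻¹) ?_ ?_
    · intro y hy
      refine HasDerivWithinAt.congr ?_ hsreal (hsreal y hy)
      have hyt : y ∈ E.target := by
        obtain ⟨x, hx, rfl⟩ := hwsurj y hy
        rw [hEt]
        exact mem_range_self x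
      have := E.hasDerivAt_symm (f' := ρ' (E.symm y) / I) hyt
        (div_pos (hρ'pos _) hI0).ne' (by
          rw [show (E : ℝ → ℝ) = w from funext hE]
          exact hw _)
      rw [hρ'eq _ (hEmaps hy)] at this
      exact this.hasDerivWithinAt
    · exact ((hρ.comp hEcont hEmaps).div_const I).inv fun y hy =>
        (div_pos (hpos _ (hEmaps hy)) hI0).ne'
  refine ⟨⟨e, hC2, hC2'⟩, I, hI0, fun x hx => ?_⟩
  exact (hder x hx).derivWithin (uniqueDiffOn_Icc_zero_one x hx)

end DiffTwo

/-! ### Averaging along a small translation -/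

/-- The average of `u` over the first `m` points of an arithmetic progression. -/
def stepAverage (u : ℝ → ℝ) (t : ℝ) (m : ℕ) (s : ℝ) : ℝ :=
  (∑ j ∈ Finset.range m, u (s + j * t)) / m

theorem abs_stepAverage_sub_le {u : ℝ → ℝ} {t c D : ℝ} {m : ℕ} (hm : 0 < m) {s : ℝ}
    (h : ∀ j < m, |u (s + j * t) - c| ≤ D) : |stepAverage u t m s - c| ≤ D := by
  have hm' : (0 : ℝ) < m := Nat.cast_pos.2 hm
  have h1 : stepAverage u t m s - c = (∑ j ∈ Finset.range m, (u (s + j * t) - c)) / m := by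
    rw [stepAverage, Finset.sum_sub_distrib, Finset.sum_const, Finset.card_range, nsmul_eq_mul,
      sub_div, mul_div_cancel_left₀ _ hm'.ne']
  rw [h1, abs_div, abs_of_pos hm', div_le_iff₀ hm']
  refine (Finset.abs_sum_le_sum_abs _ _).trans ((Finset.sum_le_card_nsmul _ _ D fun j hj =>
    h j (Finset.mem_range.1 hj)).trans ?_)
  rw [Finset.card_range, nsmul_eq_mul, mul_comm]

theorem stepAverage_sub (u v : ℝ → ℝ) (t : ℝ) (m : ℕ) (s : ℝ) :
    stepAverage (fun s => u s - v s) t m s = stepAverage u t m s - stepAverage v t m s := by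
  rw [stepAverage, stepAverage, stepAverage, Finset.sum_sub_distrib, sub_div]

theorem stepAverage_add_const (u : ℝ → ℝ) (t : ℝ) (m : ℕ) (s r : ℝ) :
    stepAverage u t m (s + r) = stepAverage (fun s => u (s + r)) t m s := by
  simp only [stepAverage, add_right_comm]

theorem hasDerivAt_stepAverage {u u' : ℝ → ℝ} (hu : ∀ s, HasDerivAt u (u' s) s) (t : ℝ)
    (m : ℕ) (s : ℝ) : HasDerivAt (stepAverage u t m) (stepAverage u' t m s) s :=
  (HasDerivAt.fun_sum fun (j : ℕ) _ => (hu (s + j * t)).comp_add_const s (j * t)).div_const _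

theorem continuous_stepAverage {u : ℝ → ℝ} (hu : Continuous u) (t : ℝ) (m : ℕ) :
    Continuous (stepAverage u t m) := by
  unfold stepAverage
  fun_prop

namespace IsFlowCoordinate

variable {γ a b : ℝ → ℝ}

theorem pow_shift {g : DiffTwo} {t : ℝ} (hγ : IsFlowCoordinate γ a b)
    (hg : ∀ s, g.real (γ s) = γ (s + t)) (j : ℕ) (s : ℝ) :
    (g ^ j).real (γ s) = γ (s + j * t) := by
  induction j with
  | zero => rw [pow_zero, DiffTwo.real_one (hγ.mem_Icc s)]; simp
  | succ j ih =>
    rw [DiffTwo.pow_succ_real', ih, hg]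
    congr 1
    push_cast
    ring

theorem continuous_a (hγ : IsFlowCoordinate γ a b) : Continuous a := by
  have h : Continuous fun s => Real.log (a s) :=
    continuous_iff_continuousAt.2 fun s => (hγ.hasDerivAt_log s).continuousAt
  have h2 := Real.continuous_exp.comp h
  rwa [show Real.exp ∘ (fun s => Real.log (a s)) = a from
    funext fun s => Real.exp_log (hγ.pos s)] at h2

/-- Averages of `b` along small steps over a unit interval are controlled by the increment of
`log a` over that interval, hence by the square root of `a`. -/
theorem exists_step_bound (hγ : IsFlowCoordinate γ a b) {K C : ℝ} (hK0 : 0 ≤ K)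
    (hK : ∀ s, |b s| ≤ K) (hC0 : 0 ≤ C)
    (hC : ∀ s, (Real.log (a (s + 1)) - Real.log (a s)) ^ 2 ≤ C * a s) {S : ℝ} (hS : 0 < S) :
    ∃ δ > 0, δ ≤ 1 ∧ ∀ t, 0 < t → t < δ → ∀ s ∈ Icc (-S - 1) (S + 1),
      stepAverage b t ⌊1 / t⌋₊ s ^ 2 ≤ 4 * (√C + 2) ^ 2 * a s := by
  obtain ⟨s₀, hs₀, hmin⟩ := isCompact_Icc.exists_isMinOn
    (nonempty_Icc.2 (show -S - 1 ≤ S + 1 by linarith)) hγ.continuous_a.continuousOn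
  set μ := √(a s₀) with hμ
  have hμ0 : 0 < μ := Real.sqrt_pos.2 (hγ.pos s₀)
  have hμle : ∀ s ∈ Icc (-S - 1) (S + 1), μ ≤ √(a s) := fun s hs => Real.sqrt_le_sqrt (hmin hs)
  obtain ⟨δ, hδ0, hδ⟩ := Metric.uniformContinuousOn_iff.1
    ((isCompact_Icc (a := -S - 1) (b := S + 2)).uniformContinuousOn_of_continuous
      hγ.cont.continuousOn) μ hμ0
  -- With t below these bounds, b varies by less than μ over one step, m t ≥ 1/2, and the leftover
  -- time 1 − m t < t changes log a by at most μ. As μ ≤ √a on the window, the two errors give the 2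
  -- in √C + 2, and dividing by m t gives the 4.
  refine ⟨min δ (min (1 / 2) (μ / (K + 1))), by positivity,
    (min_le_right _ _).trans ((min_le_left _ _).trans (by norm_num)), ?_⟩
  intro t ht0 ht s hs
  obtain ⟨ht1, ht⟩ := lt_min_iff.1 ht
  obtain ⟨ht2, ht3⟩ := lt_min_iff.1 ht
  have ht4 : K * t ≤ μ := by
    rw [lt_div_iff₀ (by positivity)] at ht3
    linarith
  set m := ⌊1 / t⌋₊ with hm
  have hm1 : m * t ≤ 1 := by
    have := Nat.floor_le (a := 1 / t) (by positivity)
    rwa [le_div_iff₀ ht0] at this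
  have hm2 : 1 - t < m * t := by
    have := Nat.lt_floor_add_one (1 / t)
    rw [div_lt_iff₀ ht0] at this
    linarith
  have hmpos : 0 < (m : ℝ) := by
    by_contra h
    nlinarith
  have hstep : ∀ j ∈ Finset.range m,
      |t * b (s + j * t) -
        (Real.log (a (s + ↑(j + 1) * t)) - Real.log (a (s + j * t)))| ≤ μ * t := by
    intro j hj
    have hj1 : ((j : ℝ) + 1) ≤ m := by exact_mod_cast Finset.mem_range.1 hj
    have hj0 : (0 : ℝ) ≤ j * t := by positivity
    have hj2 : ((j : ℝ) + 1) * t ≤ 1 := (mul_le_mul_of_nonneg_right hj1 ht0.le).trans hm1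
    have hd : ∀ x, HasDerivAt (fun x => Real.log (a x) - b (s + j * t) * x)
        (b x - b (s + j * t)) x := fun x => by
      have h := (hγ.hasDerivAt_log x).sub ((hasDerivAt_id x).const_mul (b (s + j * t)))
      rw [mul_one] at h
      exact h
    have := abs_sub_le_of_hasDerivAt (K := μ) hd (x := s + j * t) (y := s + ↑(j + 1) * t)
      fun x hx => by
        push_cast at hx
        rw [uIcc_of_le (by nlinarith)] at hx
        refine (hδ x ⟨by linarith [hx.1, hs.1], by linarith [hx.2, hs.2]⟩ _
          ⟨by linarith [hs.1], by linarith [hs.2]⟩ ?_).le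
        rw [Real.dist_eq, abs_of_nonneg (by linarith [hx.1])]
        linarith [hx.2]
    push_cast at this ⊢
    rw [show s + (j + 1) * t - (s + j * t) = t by ring, abs_of_pos ht0] at this
    rw [abs_sub_comm]
    refine le_of_eq_of_le ?_ this
    congr 1
    ring
  have hsum : |m * t * stepAverage b t m s -
      (Real.log (a (s + m * t)) - Real.log (a s))| ≤ μ := by
    have h1 := Finset.sum_range_sub (fun j : ℕ => Real.log (a (s + j * t))) m
    simp only [Nat.cast_zero, zero_mul, add_zero] at h1
    have h2 : m * t * stepAverage b t m s = ∑ j ∈ Finset.range m, t * b (s + j * t) := by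
      rw [stepAverage, ← Finset.mul_sum]
      field_simp
    rw [h2, ← h1, ← Finset.sum_sub_distrib]
    refine (Finset.abs_sum_le_sum_abs _ _).trans ((Finset.sum_le_card_nsmul _ _ _ hstep).trans ?_)
    rw [Finset.card_range, nsmul_eq_mul]
    nlinarith
  have hend : |Real.log (a (s + 1)) - Real.log (a (s + m * t))| ≤ μ := by
    refine (hγ.abs_log_sub_le hK _ _).trans ?_
    rw [abs_of_nonneg (by linarith)]
    nlinarith
  have hshift : |Real.log (a (s + 1)) - Real.log (a s)| ≤ √C * √(a s) := by
    rw [← Real.sqrt_mul hC0]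
    exact Real.abs_le_sqrt (hC s)
  have hμs := hμle s hs
  have htotal : |m * t * stepAverage b t m s| ≤ (√C + 2) * √(a s) := by
    have e1 := abs_le.1 hsum
    have e2 := abs_le.1 hend
    have e3 := abs_le.1 hshift
    rw [abs_le]
    constructor <;> nlinarith
  have hbm : |stepAverage b t m s| ≤ 2 * ((√C + 2) * √(a s)) := by
    rw [abs_mul, abs_of_nonneg (by positivity)] at htotal
    nlinarith [abs_nonneg (stepAverage b t m s)]
  calc stepAverage b t m s ^ 2 = |stepAverage b t m s| ^ 2 := (sq_abs _).symm
    _ ≤ (2 * ((√C + 2) * √(a s))) ^ 2 := by gcongr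
    _ = 4 * (√C + 2) ^ 2 * √(a s) ^ 2 := by ring
    _ = _ := by rw [Real.sq_sqrt (hγ.pos s).le]

end IsFlowCoordinate

/-! ### The flattening conjugation and its normalising constant -/

namespace IsFlowCoordinate

variable {γ a b : ℝ → ℝ}

/-- A function on `ℝ` with compact support, read in the flow coordinate and extended by zero, is
`C¹` on `[0,1]`. -/
theorem exists_contDiffOn_of_compactSupport (hγ : IsFlowCoordinate γ a b) {w : ℝ → ℝ}
    (hw : ContDiff ℝ 1 w) {S : ℝ} (hS : ∀ s, S ≤ |s| → w s = 0) :
    ∃ E : ℝ → ℝ, ContDiffOn ℝ 1 E (Icc 0 1) ∧ (∀ s, E (γ s) = w s) ∧ E 0 = 0 ∧ E 1 = 0 := by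
  obtain ⟨e, he, hes, het, hec⟩ := exists_openPartialHomeomorph hγ.hasDerivAt hγ.continuous_a hγ.pos
  have hrange : range γ = Ioo 0 1 := by
    refine Subset.antisymm (by rintro _ ⟨s, rfl⟩; exact hγ.mem s) fun x hx => ?_
    obtain ⟨s, hs⟩ := hγ.surj x hx
    exact ⟨s, hs⟩
  have hsymm : ∀ s, e.symm (γ s) = s := fun s => by
    rw [← he]
    exact e.left_inv (hes ▸ mem_univ s)
  have hval : ∀ s, (Ioo (0 : ℝ) 1).indicator (fun x => w (e.symm x)) (γ s) = w s := fun s => by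
    rw [indicator_of_mem (hγ.mem s), hsymm]
  refine ⟨(Ioo (0 : ℝ) 1).indicator fun x => w (e.symm x), fun x hx => ?_, hval, by simp, by simp⟩
  have hzero : ∀ y, (∀ s, y = γ s → w s = 0) →
      (Ioo (0 : ℝ) 1).indicator (fun x => w (e.symm x)) y = 0 := by
    intro y hy
    by_cases h : y ∈ Ioo (0 : ℝ) 1
    · obtain ⟨s, rfl⟩ := hγ.surj y h
      rw [hval, hy s rfl]
    · exact indicator_of_notMem h _
  refine ContDiffAt.contDiffWithinAt ?_
  rcases hx.1.eq_or_lt with h0 | h0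
  · refine (contDiffAt_const (c := (0 : ℝ))).congr_of_eventuallyEq ?_
    rw [← h0]
    filter_upwards [Iio_mem_nhds (hγ.mem (-|S|)).1] with y hy
    refine hzero y fun s hs => hS s ?_
    have : s < -|S| := hγ.strictMono.lt_iff_lt.1 (hs ▸ hy)
    linarith [le_abs_self S, neg_le_abs s]
  rcases hx.2.eq_or_lt with h1 | h1
  · refine (contDiffAt_const (c := (0 : ℝ))).congr_of_eventuallyEq ?_
    rw [h1]
    filter_upwards [Ioi_mem_nhds (hγ.mem |S|).2] with y hy
    refine hzero y fun s hs => hS s ?_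
    have : |S| < s := hγ.strictMono.lt_iff_lt.1 (hs ▸ hy)
    linarith [le_abs_self S, le_abs_self s]
  · obtain ⟨s, rfl⟩ := hγ.surj x ⟨h0, h1⟩
    have h2 : ContDiffAt ℝ 1 (fun x => w (e.symm x)) (γ s) :=
      hw.contDiffAt.comp (γ s) (hec s)
    refine h2.congr_of_eventuallyEq ?_
    filter_upwards [Ioo_mem_nhds h0 h1] with y hy
    exact indicator_of_mem hy _

/-- Conjugating by a diffeomorphism with derivative `R⁻¹` in the flow coordinate yields a new flow
coordinate. -/
theorem exists_conj (hγ : IsFlowCoordinate γ a b) {g : DiffTwo} {t S : ℝ} {m : ℕ} (hS : 0 < S)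
    (hm : 0 < m) (hg : ∀ s, g.real (γ s) = γ (s + t)) :
    ∃ (h : DiffTwo) (I : ℝ), 0 < I ∧
      IsFlowCoordinate (fun s => h.real (γ s))
        (fun s => 1 / (I * (Real.exp (-stepAverage (fun s => Real.log (a s)) t m s) + bump S s)))
        (fun s => (stepAverage b t m s *
          Real.exp (-stepAverage (fun s => Real.log (a s)) t m s) - bumpDeriv S s) /
          (Real.exp (-stepAverage (fun s => Real.log (a s)) t m s) + bump S s)) := by
  set L := stepAverage (fun s => Real.log (a s)) t m with hL
  have hLd : ∀ s, HasDerivAt L (stepAverage b t m s) s := hasDerivAt_stepAverage hγ.hasDerivAt_log t m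
  have hbump1 : ContDiff ℝ 1 (bump S) := by
    refine contDiff_one_iff_deriv.2 ⟨fun s => (hasDerivAt_bump S s).differentiableAt, ?_⟩
    rw [show deriv (bump S) = bumpDeriv S from funext fun s => (hasDerivAt_bump S s).deriv]
    exact continuous_bumpDeriv S
  have ha1 : ContDiff ℝ 1 a := by
    have h1 : ContDiff ℝ 1 fun s => Real.log (a s) := by
      refine contDiff_one_iff_deriv.2 ⟨fun s => (hγ.hasDerivAt_log s).differentiableAt, ?_⟩
      rw [show deriv (fun s => Real.log (a s)) = b from funext fun s => (hγ.hasDerivAt_log s).deriv]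
      exact hγ.cont
    have h2 := h1.exp
    rwa [show (fun s => Real.exp (Real.log (a s))) = a from
      funext fun s => Real.exp_log (hγ.pos s)] at h2
  obtain ⟨E, hE, hEγ, hE0, hE1⟩ := hγ.exists_contDiffOn_of_compactSupport
    (hbump1.mul ha1) (S := S) fun s hs => by
      change bump S s * a s = 0
      rw [bump_eq_zero hS hs, zero_mul]
  have hEnn : ∀ x ∈ Icc (0 : ℝ) 1, 0 ≤ E x := by
    intro x hx
    rcases hx.1.eq_or_lt with h | h
    · rw [← h, hE0]
    rcases hx.2.eq_or_lt with h' | h'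
    · rw [h', hE1]
    obtain ⟨s, rfl⟩ := hγ.surj x ⟨h, h'⟩
    rw [hEγ]
    exact mul_nonneg (bump_nonneg S s) (hγ.pos s).le
  -- In the coordinate the averaged log D(g^j) equals L − log a, so G = e^L / a. Being built from C²
  -- diffeomorphisms, G is C¹ up to the endpoints.
  let G : ℝ → ℝ := fun x => Real.exp ((∑ j ∈ Finset.range m, Real.log ((g ^ j).d1 x)) / m)
  have hG : ContDiffOn ℝ 1 G (Icc 0 1) := by
    refine ContDiffOn.exp (ContDiffOn.div_const (ContDiffOn.sum fun j _ => ?_) _)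
    exact (g ^ j).contDiffOn_d1.log fun x hx => ((g ^ j).d1_pos hx).ne'
  have hm' : (m : ℝ) ≠ 0 := (Nat.cast_pos.2 hm).ne'
  have hGγ : ∀ s, G (γ s) = Real.exp (L s) / a s := by
    intro s
    have h1 : (∑ j ∈ Finset.range m, Real.log ((g ^ j).d1 (γ s))) / m = L s - Real.log (a s) := by
      rw [Finset.sum_congr rfl fun j _ => hγ.log_d1_eq (hγ.pow_shift hg j) s,
        Finset.sum_sub_distrib, Finset.sum_const, Finset.card_range, nsmul_eq_mul, sub_div,
        mul_div_cancel_left₀ _ hm']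
      rfl
    simp only [G]
    rw [h1, Real.exp_sub, Real.exp_log (hγ.pos s)]
  have hGpos : ∀ x, 0 < G x := fun x => Real.exp_pos _
  have hden : ∀ x ∈ Icc (0 : ℝ) 1, 0 < 1 + G x * E x := fun x hx =>
    add_pos_of_pos_of_nonneg one_pos (mul_nonneg (hGpos x).le (hEnn x hx))
  -- Since E = φ a, this density times a is e^L / (1 + e^L φ) = 1 / (e^(−L) + φ).
  obtain ⟨h, I, hI, hd⟩ := DiffTwo.exists_of_d1 (ρ := fun x => G x / (1 + G x * E x))
    (hG.div (contDiffOn_const.add (hG.mul hE)) fun x hx => (hden x hx).ne')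
    (fun x hx => div_pos (hGpos x) (hden x hx))
  have hR : ∀ s, 0 < Real.exp (-L s) + bump S s := fun s =>
    add_pos_of_pos_of_nonneg (Real.exp_pos _) (bump_nonneg S s)
  have hda : ∀ s, h.d1 (γ s) * a s = 1 / (I * (Real.exp (-L s) + bump S s)) := by
    intro s
    have h1 := hγ.pos s
    have h2 := Real.exp_pos (L s)
    have h3 := hR s
    rw [Real.exp_neg] at h3 ⊢
    have h4 := hden _ (hγ.mem_Icc s)
    rw [hd _ (hγ.mem_Icc s)]
    rw [hGγ, hEγ] at h4 ⊢
    have h5 : 1 + Real.exp (L s) / a s * (bump S s * a s) =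
        Real.exp (L s) * ((Real.exp (L s))⁻¹ + bump S s) := by
      field_simp
    rw [h5]
    field_simp
  refine ⟨h, I, hI, fun s => h.real_mem_Ioo (hγ.mem s), fun y hy => ?_, fun s => ?_, fun s => ?_,
    fun s => ?_, ?_⟩
  · obtain ⟨s, hs⟩ := hγ.surj _ (h⁻¹.real_mem_Ioo hy)
    exact ⟨s, by rw [hs, DiffTwo.real_real_inv h (Ioo_subset_Icc_self hy)]⟩
  · exact one_div_pos.2 (mul_pos hI (hR s))
  · have h1 := (h.hasDerivAt_real (hγ.mem s)).comp s (hγ.hasDerivAt s)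
    rwa [hda] at h1
  · have h1 : HasDerivAt (fun s => Real.exp (-L s) + bump S s)
        (Real.exp (-L s) * -stepAverage b t m s + bumpDeriv S s) s :=
      (hLd s).neg.exp.add (hasDerivAt_bump S s)
    have h2 := ((h1.log (hR s).ne').const_add (Real.log I)).neg
    have h3 : (fun s => Real.log (1 / (I * (Real.exp (-L s) + bump S s)))) =
        fun s => -(Real.log I + Real.log (Real.exp (-L s) + bump S s)) := funext fun s => by
      rw [one_div, Real.log_inv, Real.log_mul hI.ne' (hR s).ne']
    rw [h3]
    refine h2.congr_deriv ?_
    rw [← neg_div]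
    congr 1
    ring
  · have hLc : Continuous L := continuous_iff_continuousAt.2 fun s => (hLd s).continuousAt
    exact ((((continuous_stepAverage hγ.cont t m).mul hLc.neg.rexp).sub
      (continuous_bumpDeriv S)).div (hLc.neg.rexp.add hbump1.continuous) fun s => (hR s).ne')

/-- The normalising constant of the flattened vector field is small as soon as the bump is wide. -/
theorem normalisation_le {R B : ℝ → ℝ} {I : ℝ} (hI : 0 < I) (hγ : IsFlowCoordinate γ a b)
    {h : DiffTwo} {S c : ℝ} (hS : 0 < S)
    (hH : IsFlowCoordinate (fun s => h.real (γ s)) (fun s => 1 / (I * R s)) B)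
    (hR : ∀ s, 1 ≤ c * a s * R s) (hRS : ∀ s, |s| ≤ S / 2 → S ^ 2 / 2 ≤ R s) :
    I ≤ c * (γ (-(S / 2)) + (1 - γ (S / 2))) + 2 / S := by
  have hRpos : ∀ s, 0 < R s := fun s => by
    have := hH.pos s
    rw [one_div, inv_pos] at this
    exact pos_of_mul_pos_right this hI.le
  have hd : ∀ x ∈ Ioo (0 : ℝ) 1, h.d1 x * I ≤ c := by
    intro x hx
    obtain ⟨s, rfl⟩ := hγ.surj x hx
    have h1 := ((h.hasDerivAt_real (hγ.mem s)).comp s (hγ.hasDerivAt s)).unique (hH.hasDerivAt s)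
    have h2 := hR s
    have h3 := hγ.pos s
    have h4 := hRpos s
    rw [eq_div_iff (by positivity)] at h1
    have h5 : 0 < a s * R s := by positivity
    refine le_of_mul_le_mul_right ?_ h5
    linarith
  have hseg : ∀ x y : ℝ, 0 ≤ x → x < y → y ≤ 1 → (h.real y - h.real x) * I ≤ c * (y - x) := by
    intro x y hx hxy hy
    obtain ⟨z, hz, hz'⟩ := exists_hasDerivAt_eq_slope h.real h.d1 hxy
      (h.continuousOn_real.mono (Icc_subset_Icc hx hy))
      (fun z hz => h.hasDerivAt_real ⟨hx.trans_lt hz.1, hz.2.trans_le hy⟩)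
    have h1 := hd z ⟨hx.trans_lt hz.1, hz.2.trans_le hy⟩
    rw [eq_div_iff (by linarith)] at hz'
    rw [← hz']
    nlinarith
  -- I is split along the image of h: on the two end segments I · Dh ≤ c, and the middle, where R ≥
  -- S²/2, contributes at most S · 2/S².
  have h1 := hseg 0 (γ (-(S / 2))) le_rfl (hγ.mem _).1 (hγ.mem _).2.le
  have h2 := hseg (γ (S / 2)) 1 (hγ.mem _).1.le (hγ.mem _).2 le_rfl
  have h3 : (h.real (γ (S / 2)) - h.real (γ (-(S / 2)))) * I ≤ 2 / S := by
    obtain ⟨z, hz, hz'⟩ := exists_hasDerivAt_eq_slope (fun s => h.real (γ s))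
      (fun s => 1 / (I * R s)) (show -(S / 2) < S / 2 by linarith)
      hH.continuous.continuousOn (fun z _ => hH.hasDerivAt z)
    have h4 := hRS z (abs_le.2 ⟨hz.1.le, hz.2.le⟩)
    have h5 := hRpos z
    rw [show S / 2 - -(S / 2) = S by ring, eq_div_iff hS.ne'] at hz'
    rw [← hz', le_div_iff₀ hS]
    have h6 : 1 / (I * R z) * S * I * S = S ^ 2 / R z := by field_simp
    rw [h6, div_le_iff₀ h5]
    linarith
  rw [DiffTwo.real_zero] at h1
  rw [DiffTwo.real_at_one] at h2
  linarith

end IsFlowCoordinate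

/-! ### Choice of the parameters and conclusion -/

namespace DiffTwo

theorem flattenable_of_movesDown_inv {f : DiffTwo} (hdown : f⁻¹.MovesDown) (h0 : f.d1 0 = 1)
    (h1 : f.d1 1 = 1) (hcent : ¬ IsInfiniteCyclic f.c2Centralizer) : f.Flattenable := by
  have h0' : f⁻¹.d1 0 = 1 := by
    have := f.d1_inv (left_mem_Icc.2 zero_le_one)
    rwa [real_zero, h0, inv_one] at this
  obtain ⟨γ, a, b, hγ, hf, hcomm⟩ := exists_flowCoordinate hdown h0'
  obtain ⟨K, hK0, hK⟩ := hγ.exists_bound hf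
  obtain ⟨C, hC0, hC⟩ := hγ.exists_sq_log_shift_le hf h0 h1 hK0 hK
  obtain ⟨N, hN0, hN⟩ := f.exists_nl_bound
  set M := Real.exp K with hM
  have hM1 : 1 ≤ M := Real.one_le_exp hK0
  -- Here P = e^(−L). The value of d comes from a ≤ M and 1 ≤ M a P; that of A from increments of
  -- the averaged b being at most N M a, with a P ≤ M; that of k from `exists_step_bound`. None
  -- depends on S or t.
  obtain ⟨Cb, hCb0, hCb⟩ := exists_second_difference_bound (M := M) (d := M) (A := N * M ^ 2)
    (k := 2 * (√C + 2) * M) hM1 (by positivity) (by positivity) (by positivity)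
  intro ε hε
  -- the width of the bump
  set η := min (1 / 2) (ε / ((Cb + 1) * (2 * M + 2))) with hη
  have hη0 : 0 < η := by positivity
  have hη1 : η ≤ 1 / 2 := min_le_left _ _
  have hηε : Cb * (η * (2 * M + 2)) ≤ ε := by
    have h2 : η ≤ ε / ((Cb + 1) * (2 * M + 2)) := min_le_right _ _
    rw [le_div_iff₀ (by positivity)] at h2
    have h3 : 0 ≤ η * (2 * M + 2) := by positivity
    linarith
  obtain ⟨s₁, hs₁⟩ := hγ.surj η ⟨hη0, by linarith⟩
  obtain ⟨s₂, hs₂⟩ := hγ.surj (1 - η) ⟨by linarith, by linarith⟩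
  -- S/2 exceeds |s₁| and |s₂|, so each tail of γ has length at most η, and the term 1/η gives 2/S ≤
  -- 2η.
  set S := 2 * (|s₁| + |s₂|) + 1 / η with hSdef
  have hη' : 0 < 1 / η := by positivity
  have hS : 0 < S := by positivity
  have hS1 : γ (-(S / 2)) ≤ η := by
    rw [← hs₁]
    exact hγ.strictMono.monotone (by linarith [neg_abs_le s₁, abs_nonneg s₂])
  have hS2 : 1 - η ≤ γ (S / 2) := by
    rw [← hs₂]
    exact hγ.strictMono.monotone (by linarith [le_abs_self s₂, abs_nonneg s₁])
  have hS3 : 2 / S ≤ 2 * η := by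
    rw [div_le_iff₀ hS]
    have : η * (1 / η) = 1 := by field_simp
    nlinarith [abs_nonneg s₁, abs_nonneg s₂]
  -- the averaging step
  obtain ⟨δ, hδ0, hδ1, hδ⟩ := hγ.exists_step_bound hK0 hK hC0 hC hS
  obtain ⟨g, t, ht0, htδ, hg⟩ := hγ.exists_small_shift hf hcomm hcent hδ0
  have hstep := hδ t ht0 htδ
  have hm : 0 < ⌊1 / t⌋₊ := by
    rw [Nat.floor_pos, le_div_iff₀ ht0]
    linarith
  have hjt : ∀ j < ⌊1 / t⌋₊, |(j : ℝ) * t| ≤ 1 := by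
    intro j hj
    have h2 : (j : ℝ) ≤ 1 / t :=
      (Nat.cast_le.2 hj.le).trans (Nat.floor_le (by positivity))
    rw [abs_of_nonneg (by positivity)]
    rwa [le_div_iff₀ ht0] at h2
  set m := ⌊1 / t⌋₊
  obtain ⟨h, I, hI, hH⟩ := hγ.exists_conj hS hm hg
  set L := stepAverage (fun s => Real.log (a s)) t m with hL
  set bm := stepAverage b t m with hbm
  have hLd : ∀ s, HasDerivAt L (bm s) s := hasDerivAt_stepAverage hγ.hasDerivAt_log t m
  have hLK : ∀ s, |L s - Real.log (a s)| ≤ K := fun s =>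
    abs_stepAverage_sub_le hm fun j hj => by
      refine (hγ.abs_log_sub_le hK _ _).trans ?_
      rw [add_sub_cancel_left]
      exact mul_le_of_le_one_right hK0 (hjt j hj)
  have hbK : ∀ s, |bm s| ≤ K := fun s => by
    have := abs_stepAverage_sub_le (u := b) (t := t) (c := 0) hm (s := s) (D := K)
      fun j _ => by rw [sub_zero]; exact hK _
    rwa [sub_zero] at this
  have hLlip : ∀ x y, |x - y| ≤ 1 → Real.exp (-L x) ≤ M * Real.exp (-L y) := by
    intro x y hxy
    rw [hM, ← Real.exp_add, Real.exp_le_exp]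
    have h2 := (abs_le.1 (abs_sub_le_of_hasDerivAt (K := K) hLd (x := y) (y := x)
      fun s _ => hbK s)).1
    nlinarith
  have hPa : ∀ s, Real.exp (-L s) * a s ≤ M := fun s => by
    nth_rewrite 1 [← Real.exp_log (hγ.pos s)]
    rw [← Real.exp_add, Real.exp_le_exp]
    linarith [(abs_le.1 (hLK s)).1]
  have haP : ∀ s, 1 ≤ M * a s * Real.exp (-L s) := fun s => by
    nth_rewrite 1 [← Real.exp_log (hγ.pos s)]
    rw [← Real.exp_add, ← Real.exp_add]
    exact Real.one_le_exp (by linarith [(abs_le.1 (hLK s)).2])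
  have haM : ∀ s, a s ≤ M := fun s => by
    refine (hγ.shift_sub_le hK0 hK s).1.trans ?_
    exact mul_le_of_le_one_right (Real.exp_pos K).le
      (by linarith [(hγ.mem (s + 1)).2, (hγ.mem s).1])
  have hMM : M ≤ M ^ 2 := by nlinarith
  have hPpos : ∀ s, 0 < Real.exp (-L s) := fun s => Real.exp_pos _
  have hkey := hCb S (fun s => Real.exp (-L s)) bm hS hPpos
    (fun s => ((hLd s).neg.exp).congr_deriv (by simp only [Pi.neg_apply]; ring))
    (fun s r hr => (hLlip _ _ (by
      rw [add_sub_cancel_left, abs_of_nonneg hr.1]; exact hr.2)).trans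
        (mul_le_mul_of_nonneg_right hMM (hPpos s).le))
    (fun s => (hLlip _ _ (by simp)).trans
        (mul_le_mul_of_nonneg_right hMM (hPpos _).le))
    (fun s => by
      refine (haP s).trans ?_
      rw [sq]
      have := haM s
      have := (hPpos s).le
      gcongr)
    (fun s => by
      have h2 : |bm (s + 1) - bm s| ≤ N * M * a s := by
        rw [hbm, stepAverage_add_const, ← stepAverage_sub]
        have := abs_stepAverage_sub_le (u := fun s => b (s + 1) - b s) (t := t) (c := 0) hm
          (s := s) (D := N * M * a s) fun j hj => by
            rw [sub_zero, mul_assoc]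
            refine (hγ.abs_shift_sub_le hf hN _).trans (mul_le_mul_of_nonneg_left ?_ hN0)
            exact hγ.le_exp_mul hK0 hK (by rw [add_sub_cancel_left]; exact hjt j hj)
        rwa [sub_zero] at this
      calc |bm (s + 1) - bm s| * Real.exp (-L s) ≤ N * M * a s * Real.exp (-L s) := by gcongr
        _ = N * M * (Real.exp (-L s) * a s) := by ring
        _ ≤ N * M * M := by gcongr; exact hPa s
        _ = _ := by ring)
    (fun s hs => by
      calc bm s ^ 2 * Real.exp (-L s) ≤ 4 * (√C + 2) ^ 2 * a s * Real.exp (-L s) := by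
            gcongr
            exact hstep s hs
        _ = 4 * (√C + 2) ^ 2 * (Real.exp (-L s) * a s) := by ring
        _ ≤ 4 * (√C + 2) ^ 2 * M ^ 2 := by gcongr; exact (hPa s).trans hMM
        _ = _ := by ring)
  have hIle : I ≤ η * (2 * M + 2) := by
    have h2 := hγ.normalisation_le hI hS hH (c := M)
      (fun s => (haP s).trans (mul_le_mul_of_nonneg_left
        (le_add_of_nonneg_right (bump_nonneg S s))
        (mul_nonneg (Real.exp_pos K).le (hγ.pos s).le)))
      (fun s hs => (le_bump hS hs).trans (le_add_of_nonneg_left (hPpos s).le))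
    have h3 : M * (γ (-(S / 2)) + (1 - γ (S / 2))) ≤ M * (η + η) := by
      gcongr
      linarith
    linarith
  refine ⟨h, fun y hy => ?_⟩
  obtain ⟨s, rfl⟩ := hH.surj y hy
  have hconj : ∀ s, (h * f * h⁻¹).real (h.real (γ s)) = h.real (γ (s + 1)) := fun s => by
    rw [real_mul, real_mul, real_inv_real h (hγ.mem_Icc s), hf]
  -- The first difference of the new b is the nonlinearity divided by I R, so `hkey` says that the
  -- nonlinearity is at most Cb · I.
  have h2 := hH.nl_mul_eq (g := h * f * h⁻¹) hconj s
  have h3 := hkey s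
  have hR : 0 < Real.exp (-L s) + bump S s :=
    add_pos_of_pos_of_nonneg (hPpos s) (bump_nonneg S s)
  rw [← h2, abs_mul, abs_of_pos (one_div_pos.2 (mul_pos hI hR)), mul_assoc] at h3
  have h4 : 1 / (I * (Real.exp (-L s) + bump S s)) * (Real.exp (-L s) + bump S s) = 1 / I := by
    field_simp
  rw [h4, mul_one_div, div_le_iff₀ hI] at h3
  calc _ ≤ Cb * I := h3
    _ ≤ Cb * (η * (2 * M + 2)) := by gcongr
    _ ≤ ε := hηε

theorem c2Centralizer_inv (f : DiffTwo) : f⁻¹.c2Centralizer = f.c2Centralizer := by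
  ext g
  rw [c2Centralizer, c2Centralizer, Subgroup.mem_centralizer_singleton_iff,
    Subgroup.mem_centralizer_singleton_iff]
  exact Commute.inv_right_iff (a := g) (b := f)

/-- A diffeomorphism without interior fixed points moves all interior points in one direction. -/
theorem NoInteriorFixedPoint.movesDown_or {f : DiffTwo} (hf : f.NoInteriorFixedPoint) :
    f.MovesDown ∨ f⁻¹.MovesDown := by
  by_contra! hcon
  obtain ⟨h1, h2⟩ := hcon
  simp only [MovesDown, not_forall, not_lt] at h1 h2
  obtain ⟨x, hx, hxf⟩ := h1
  obtain ⟨y, hy, hyf⟩ := h2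
  have hz := f⁻¹.real_mem_Ioo hy
  have hzf : f.real (f⁻¹.real y) ≤ f⁻¹.real y := by
    rwa [real_real_inv f (Ioo_subset_Icc_self hy)]
  have hcont : ContinuousOn (fun z => f.real z - z) (Ioo 0 1) :=
    (f.continuousOn_real.mono Ioo_subset_Icc_self).sub continuousOn_id
  obtain ⟨z, hz, hz0⟩ := isPreconnected_Ioo.intermediate_value hz hx hcont
    (show (0 : ℝ) ∈ Icc _ _ from ⟨by linarith, by linarith⟩)
  exact hf z hz (sub_eq_zero.1 hz0)

end DiffTwo

end

theorem theoremH (f : DiffTwo)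
    (hΔ : f.NoInteriorFixedPoint)
    (h₀ : f.IsParabolicFixedPoint 0) (h₁ : f.IsParabolicFixedPoint 1)
    (hcent : ¬ IsInfiniteCyclic f.c2Centralizer) :
    (1 : DiffTwo) ∈ closure (conjugatesOf f) := by
  have e0 : f.d1 0 = 1 := h₀.2.2
  have e1 : f.d1 1 = 1 := h₁.2.2
  refine DiffTwo.Flattenable.one_mem_closure ?_
  rcases hΔ.movesDown_or with h | h
  · refine DiffTwo.Flattenable.of_inv ?_
    refine DiffTwo.flattenable_of_movesDown_inv (by rwa [inv_inv]) ?_ ?_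
      (by rwa [DiffTwo.c2Centralizer_inv])
    · have := f.d1_inv (Set.left_mem_Icc.2 zero_le_one)
      rwa [f.real_zero, e0, inv_one] at this
    · have := f.d1_inv (Set.right_mem_Icc.2 zero_le_one)
      rwa [f.real_at_one, e1, inv_one] at this
  · exact DiffTwo.flattenable_of_movesDown_inv h e0 e1 hcent
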